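/- Let $\delta>0$, $\delta\neq 1$, and consider, for a real function $u$ of the complex variables $(z^1,z^2)\in\mathbb C^2$, the real general heavenly equation of neutral signature $$(\delta^2-1)\,u_{1\bar 1}u_{2\bar 2}=\delta^2\,u_{12}u_{\bar 1\bar 2}-u_{1\bar 2}u_{2\bar 1},$$ where subscripts $i,\bar i$ denote the derivatives $\partial_i=\partial/\partial z^i$, $\partial_{\bar i}=\partial/\partial\bar z^i$. Write the equation as $F=0$. A smooth (complexified) vector field $X=\xi^1\partial_1+\xi^{\bar 1}\partial_{\bar 1}+\xi^2\partial_2+\xi^{\bar 2}\partial_{\bar 2}+\eta\,\partial_u$ on an open set $U\subset\mathbb C^2\times\mathbb R$, with coefficients depending on $(z^1,\bar z^1,z^2,\bar z^2,u)$, is called a point symmetry generator of the equation on $U$ if its second prolongation satisfies $\mathrm{pr}^{(2)}X(F)=0$ at every second-order jet over $U$ at which $F=0$. (1) If $U$ is convex, then the point symmetry generators on $U$ are exactly the complex linear combinations of $$X_1=a(z^1)\partial_1,\quad \bar X_1=\bar a(\bar z^1)\partial_{\bar 1},\quad X_2=b(z^2)\partial_2,\quad \bar X_2=\bar b(\bar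 z^2)\partial_{\bar 2},\quad X_3=u\,\partial_u,$$ $$X_4=c(z^1)\partial_u,\quad \bar X_4=\bar c(\bar z^1)\partial_u,\quad X_5=d(z^2)\partial_u,\quad \bar X_5=\bar d(\bar z^2)\partial_u,$$ where $a,c$ (respectively $b,d$) are arbitrary holomorphic functions of one variable on the projection of $U$ to the $z^1$-plane (respectively $z^2$-plane), and the bar denotes the complex conjugate function. The real point symmetry generators (those with $\xi^{\bar 1}=\overline{\xi^1}$, $\xi^{\bar 2}=\overline{\xi^2}$ and $\eta$ real) are exactly the vector fields $X_1+\bar X_1+X_2+\bar X_2+kX_3+X_4+\bar X_4+X_5+\bar X_5$ with $a,b,c,d$ as above and $k\in\mathbb R$. (2) On an arbitrary open set $U$, a vector field is a point symmetry generator (respectively a real one) if and only if it has the corresponding form of (1) in an open neighbourhood of each point of $U$. (3) The point symmetry generators on $U$ are closed under the commutator of vector fields. -/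

import Mathlib

open Set
open scoped ContDiff

noncomputable section

namespace Heavenly

/-- The space `ℂ²` of the independent variables `(z¹, z²)`, as a real manifold. -/
abbrev Base : Type := ℂ × ℂ

/-- The space `ℂ² × ℝ` of the variables `((z¹, z²), u)`, with `u` the real dependent variable. -/
abbrev Total : Type := (ℂ × ℂ) × ℝ

/-- `(∂_v f - i ∂_w f) / 2`: the Wirtinger derivative `∂/∂z` in the complex coordinate `z = s + i t`
when `v`, `w` are the coordinate directions of `s`, `t`. -/
def dHol {E : Type*} [NormedAddCommGroup E] [NormedSpace ℝ E] (v w : E) (f : E → ℂ) : E → ℂ :=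
  fun x => (fderiv ℝ f x v - Complex.I * fderiv ℝ f x w) / 2

/-- `(∂_v f + i ∂_w f) / 2`: the Wirtinger derivative `∂/∂z̄`. -/
def dAnti {E : Type*} [NormedAddCommGroup E] [NormedSpace ℝ E] (v w : E) (f : E → ℂ) : E → ℂ :=
  fun x => (fderiv ℝ f x v + Complex.I * fderiv ℝ f x w) / 2

/-- The derivatives `∂₁, ∂_{1̄}, ∂₂, ∂_{2̄}` (in this order) of a function of `(z¹, z²)`. -/
def pd : Fin 4 → (Base → ℂ) → Base → ℂ :=
  ![dHol (1, 0) (Complex.I, 0), dAnti (1, 0) (Complex.I, 0),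
    dHol (0, 1) (0, Complex.I), dAnti (0, 1) (0, Complex.I)]

/-- The derivatives `∂₁, ∂_{1̄}, ∂₂, ∂_{2̄}` (in this order) of a function of `((z¹, z²), u)`,
taken at fixed `u`. -/
def pdTotal : Fin 4 → (Total → ℂ) → Total → ℂ :=
  ![dHol ((1, 0), 0) ((Complex.I, 0), 0), dAnti ((1, 0), 0) ((Complex.I, 0), 0),
    dHol ((0, 1), 0) ((0, Complex.I), 0), dAnti ((0, 1), 0) ((0, Complex.I), 0)]

/-- The derivative `∂_u` of a function of `((z¹, z²), u)`. -/
def pdU (f : Total → ℂ) : Total → ℂ := fun p => fderiv ℝ f p (0, 1)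

/-- The array of second derivatives `u_{ij}`, `i, j ∈ {1, 1̄, 2, 2̄}`. -/
def hess (f : Base → ℂ) (x : Base) : Fin 4 → Fin 4 → ℂ := fun i j => pd i (pd j f) x

/-- Left side minus right side of the equation
`(δ² - 1) u_{11̄} u_{22̄} = δ² u_{12} u_{1̄2̄} - u_{12̄} u_{21̄}`,
as a function of the second derivatives. -/
def heavenly (δ : ℝ) (H : Fin 4 → Fin 4 → ℂ) : ℂ :=
  ((δ : ℂ) ^ 2 - 1) * (H 0 1 * H 2 3) - ((δ : ℂ) ^ 2 * (H 0 2 * H 1 3) - H 0 3 * H 2 1)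

/-- A (complexified) vector field
`ξ¹ ∂₁ + ξ^{1̄} ∂_{1̄} + ξ² ∂₂ + ξ^{2̄} ∂_{2̄} + η ∂_u` on `ℂ² × ℝ`, given by
its components `(ξ, η)`. -/
abbrev VField : Type := Total → (Fin 4 → ℂ) × ℂ

/-- The action of a vector field on a function. -/
def VField.act (X : VField) (f : Total → ℂ) : Total → ℂ :=
  fun p => ∑ k, (X p).1 k * pdTotal k f p + (X p).2 * pdU f p

/-- The commutator of two vector fields. -/
def VField.bracket (X Y : VField) : VField := fun p =>
  (fun k => VField.act X (fun q => (Y q).1 k) p - VField.act Y (fun q => (X q).1 k) p,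
    VField.act X (fun q => (Y q).2) p - VField.act Y (fun q => (X q).2) p)

/-- The vector field is real on `U`: `ξ^{1̄}`, `ξ^{2̄}` are conjugate to `ξ¹`, `ξ²`, and `η` is real. -/
def VField.IsReal (U : Set Total) (X : VField) : Prop :=
  ∀ p ∈ U, (X p).1 1 = star ((X p).1 0) ∧ (X p).1 3 = star ((X p).1 2) ∧ (X p).2.im = 0

/-- The characteristic `Q = η - ∑ ξᵏ u_k` of a vector field, evaluated along a function `u`. -/
def characteristic (X : VField) (u : Base → ℝ) : Base → ℂ := fun x =>
  (X (x, u x)).2 - ∑ k, (X (x, u x)).1 k * pd k (fun y => (u y : ℂ)) x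

/-- The coefficients `φ^{ij} = D_i D_j Q + ∑ ξᵏ u_{ijk}` of `∂/∂u_{ij}` in the second prolongation
of a vector field, evaluated at the jet of the function `u` at the point `x`. -/
def prolong (X : VField) (u : Base → ℝ) (x : Base) : Fin 4 → Fin 4 → ℂ := fun i j =>
  pd i (pd j (characteristic X u)) x
    + ∑ k, (X (x, u x)).1 k * pd i (pd j (pd k fun y => (u y : ℂ))) x

/-- `X` generates point symmetries, on `U`, of the equation `F = 0` with `F = heavenly δ`:
it is smooth, and `pr⁽²⁾X (F) = 0` at each second-order jet over `U` with `F = 0`. The jets are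
those of smooth functions `u` at points `x`; since `F` depends on the second derivatives only,
`pr⁽²⁾X (F) = ∑ φ^{ij} ∂F/∂u_{ij}` is the derivative of `F` in the direction `φ`. -/
def IsPointSymmetry (δ : ℝ) (U : Set Total) (X : VField) : Prop :=
  ContDiffOn ℝ ∞ X U ∧
    ∀ u : Base → ℝ, ContDiff ℝ ∞ u → ∀ x : Base, (x, u x) ∈ U →
      heavenly δ (hess (fun y => (u y : ℂ)) x) = 0 →
        lineDeriv ℂ (heavenly δ) (hess (fun y => (u y : ℂ)) x) (prolong X u x) = 0

/-- The vector field `f ∂_k`, with `k` one of `1, 1̄, 2, 2̄`. -/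
def horizontal (k : Fin 4) (f : Total → ℂ) : VField := fun p => (Pi.single k (f p), 0)

/-- The vector field `f ∂_u`. -/
def vertical (f : Total → ℂ) : VField := fun p => (0, f p)

/-- `X₁ = a(z¹) ∂₁`. -/
def X₁ (a : ℂ → ℂ) : VField := horizontal 0 fun p => a p.1.1
/-- `X̄₁ = ā(z̄¹) ∂_{1̄}`, where `ā(z̄¹)` is the conjugate of `a(z¹)`. -/
def X₁bar (a : ℂ → ℂ) : VField := horizontal 1 fun p => star (a p.1.1)
/-- `X₂ = b(z²) ∂₂`. -/
def X₂ (b : ℂ → ℂ) : VField := horizontal 2 fun p => b p.1.2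
/-- `X̄₂ = b̄(z̄²) ∂_{2̄}`. -/
def X₂bar (b : ℂ → ℂ) : VField := horizontal 3 fun p => star (b p.1.2)
/-- `X₃ = u ∂_u`. -/
def X₃ : VField := vertical fun p => (p.2 : ℂ)
/-- `X₄ = c(z¹) ∂_u`. -/
def X₄ (c : ℂ → ℂ) : VField := vertical fun p => c p.1.1
/-- `X̄₄ = c̄(z̄¹) ∂_u`. -/
def X₄bar (c : ℂ → ℂ) : VField := vertical fun p => star (c p.1.1)
/-- `X₅ = d(z²) ∂_u`. -/
def X₅ (d : ℂ → ℂ) : VField := vertical fun p => d p.1.2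
/-- `X̄₅ = d̄(z̄²) ∂_u`. -/
def X₅bar (d : ℂ → ℂ) : VField := vertical fun p => star (d p.1.2)

/-- `g` is a holomorphic function of `z¹`, for the points `((z¹, z²), u)` of `U`. -/
def Hol₁ (U : Set Total) (g : ℂ → ℂ) : Prop := DifferentiableOn ℂ g ((fun p : Total => p.1.1) '' U)

/-- `g` is a holomorphic function of `z²`, for the points `((z¹, z²), u)` of `U`. -/
def Hol₂ (U : Set Total) (g : ℂ → ℂ) : Prop := DifferentiableOn ℂ g ((fun p : Total => p.1.2) '' U)

/-- The listed symmetry generators over `U`. -/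
inductive IsGenerator (U : Set Total) : VField → Prop
  | x1 (a : ℂ → ℂ) (h : Hol₁ U a) : IsGenerator U (X₁ a)
  | x1bar (a : ℂ → ℂ) (h : Hol₁ U a) : IsGenerator U (X₁bar a)
  | x2 (b : ℂ → ℂ) (h : Hol₂ U b) : IsGenerator U (X₂ b)
  | x2bar (b : ℂ → ℂ) (h : Hol₂ U b) : IsGenerator U (X₂bar b)
  | x3 : IsGenerator U X₃
  | x4 (c : ℂ → ℂ) (h : Hol₁ U c) : IsGenerator U (X₄ c)
  | x4bar (c : ℂ → ℂ) (h : Hol₁ U c) : IsGenerator U (X₄bar c)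
  | x5 (d : ℂ → ℂ) (h : Hol₂ U d) : IsGenerator U (X₅ d)
  | x5bar (d : ℂ → ℂ) (h : Hol₂ U d) : IsGenerator U (X₅bar d)

/-- On `U`, the vector field `X` is a complex linear combination of listed generators. -/
def IsGenerated (U : Set Total) (X : VField) : Prop :=
  ∃ Y ∈ Submodule.span ℂ {Z : VField | IsGenerator U Z}, EqOn X Y U

/-- On `U`, the vector field `X` is a real combination
`X₁ + X̄₁ + X₂ + X̄₂ + k X₃ + X₄ + X̄₄ + X₅ + X̄₅` of the listed generators. -/
def IsRealGenerated (U : Set Total) (X : VField) : Prop :=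
  ∃ (a b c d : ℂ → ℂ) (k : ℝ), Hol₁ U a ∧ Hol₂ U b ∧ Hol₁ U c ∧ Hol₂ U d ∧
    EqOn X (X₁ a + X₁bar a + X₂ b + X₂bar b + (k : ℂ) • X₃
      + X₄ c + X₄bar c + X₅ d + X₅bar d) U

end Heavenly

end

/-!
The symmetry condition is turned into a linear, local system of first- and second-order equations
for the components of `X` (`Determining`), which is then solved.

Since `F` is a quadratic form in the second derivatives, `pr⁽²⁾X (F)` is its polarization at
`(u_{ij}, φ^{ij})`, and the third derivatives of `u` cancel in `φ^{ij}`
(`prolong_eq_prolongJet`, `lineDeriv_heavenly`). Every real second-order jet is the jet of a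
quadratic polynomial (`exists_jet`), so the symmetry condition is an identity in the jet variables
on the real cone `F = 0`. Two features of this cone suffice:

* `F` does not involve `u_{11}`, `u_{22}` and their conjugates, so their coefficients in
  `pr⁽²⁾X (F)` vanish separately. Evaluated at a few points of the cone, this says that `ξᵏ` depends
  on the `k`-th of the variables `z¹, z̄¹, z², z̄²` only (`IsPointSymmetry.totD_eq_zero`). What is left
  of `pr⁽²⁾X (F)` is a multiple of `F` plus a term linear in the off-diagonal second derivatives with
  coefficients from `η` (`polar_prolongJet_of_xi`).
* The real points of the cone span the space of off-diagonal second derivatives, so these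
  coefficients vanish (`eq_zero_of_polar`); as polynomials in the first derivatives of `u` they give
  `η_{uu} = η_{iu} = 0`, and `η_{ij} = 0` for `i ≠ j`.

On a convex open set the determining equations integrate explicitly: a function annihilated by all
`∂_j` with `j ≠ k` and by `∂_u` is constant on the convex fibres of the projection to the `k`-th
variable, hence a holomorphic or antiholomorphic function on the projection
(`exists_holomorphic_factor`); `η` is recovered from its first derivatives by taking primitives on the
projections, which are convex as well (`Determining.hasNormalForm`). Conversely every combination of
generators satisfies the determining equations (`HasNormalForm.determining`), on any open set. The
local statement follows as the determining equations are local and balls are convex, and the closure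
under commutators follows by computing the commutator of two local normal forms
(`HasNormalForm.bracket`).
-/

noncomputable section

namespace Heavenly

/-! ### Constant complexified vector fields -/

section ConstantFields

variable {E : Type*} [NormedAddCommGroup E] [NormedSpace ℝ E]

/-- The derivative of `f` along the constant complexified vector field `v + i w`. All of `∂_k`
(on `ℂ²` and on `ℂ² × ℝ`) and `∂_u` are of this form, which gives them a common calculus. -/
def cdir (v w : E) (f : E → ℂ) : E → ℂ :=
  fun x => fderiv ℝ f x v + Complex.I * fderiv ℝ f x w

variable {v w v' w' : E} {f g : E → ℂ} {x : E}

theorem cdir_congr (h : f =ᶠ[nhds x] g) : cdir v w f x = cdir v w g x := by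
  simp only [cdir, h.fderiv_eq]

theorem cdir_add (hf : DifferentiableAt ℝ f x) (hg : DifferentiableAt ℝ g x) :
    cdir v w (fun y => f y + g y) x = cdir v w f x + cdir v w g x := by
  simp only [cdir, fderiv_fun_add hf hg, add_apply]; ring

theorem cdir_sub (hf : DifferentiableAt ℝ f x) (hg : DifferentiableAt ℝ g x) :
    cdir v w (fun y => f y - g y) x = cdir v w f x - cdir v w g x := by
  simp only [cdir, fderiv_fun_sub hf hg, sub_apply]; ring

theorem cdir_mul (hf : DifferentiableAt ℝ f x) (hg : DifferentiableAt ℝ g x) :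
    cdir v w (fun y => f y * g y) x = cdir v w f x * g x + f x * cdir v w g x := by
  simp only [cdir, fderiv_fun_mul hf hg, add_apply,
    smul_apply, smul_eq_mul]; ring

theorem cdir_const (c : ℂ) : cdir v w (fun _ => c) x = 0 := by
  simp [cdir]

theorem cdir_sum {ι : Type*} (s : Finset ι) {F : ι → E → ℂ}
    (h : ∀ i ∈ s, DifferentiableAt ℝ (F i) x) :
    cdir v w (fun y => ∑ i ∈ s, F i y) x = ∑ i ∈ s, cdir v w (F i) x := by
  simp only [cdir, fderiv_fun_sum h, sum_apply, Finset.sum_add_distrib,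
    Finset.mul_sum]

theorem cdir_contDiffAt (hf : ContDiffAt ℝ ∞ f x) : ContDiffAt ℝ ∞ (cdir v w f) x := by
  have h : ContDiffAt ℝ ∞ (fderiv ℝ f) x := hf.fderiv_right (by simp)
  unfold cdir
  exact (h.clm_apply contDiffAt_const).add
    (contDiffAt_const.mul (h.clm_apply contDiffAt_const))

theorem cdir_comm (hf : ContDiffAt ℝ ∞ f x) :
    cdir v w (cdir v' w' f) x = cdir v' w' (cdir v w f) x := by
  have h : DifferentiableAt ℝ (fderiv ℝ f) x :=
    (hf.fderiv_right (m := ∞) (by simp)).differentiableAt (by simp)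
  have key : ∀ a b c : E, fderiv ℝ (fun y => fderiv ℝ f y a + Complex.I * fderiv ℝ f y b) x c
      = fderiv ℝ (fderiv ℝ f) x c a + Complex.I * fderiv ℝ (fderiv ℝ f) x c b := by
    intro a b c
    have h1 : HasFDerivAt (fun y => fderiv ℝ f y a) ((fderiv ℝ (fderiv ℝ f) x).flip a) x := by
      simpa using h.hasFDerivAt.clm_apply (hasFDerivAt_const a x)
    have h2 : HasFDerivAt (fun y => fderiv ℝ f y b) ((fderiv ℝ (fderiv ℝ f) x).flip b) x := by
      simpa using h.hasFDerivAt.clm_apply (hasFDerivAt_const b x)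
    rw [show (fun y => fderiv ℝ f y a + Complex.I * fderiv ℝ f y b)
      = (fun y => fderiv ℝ f y a) + fun y => Complex.I * fderiv ℝ f y b from rfl,
      (h1.add (h2.const_mul Complex.I)).fderiv]
    simp
  have hs : IsSymmSndFDerivAt ℝ f x := hf.isSymmSndFDerivAt (by
    simpa using WithTop.coe_le_coe.2 (OrderTop.le_top (2 : ℕ∞)))
  unfold cdir
  rw [key, key, key, key, hs v' v, hs v' w, hs w' v, hs w' w]
  ring

/-- Conjugating the function conjugates the constant vector field. -/
theorem cdir_star (hf : DifferentiableAt ℝ f x) :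
    cdir v w (fun y => star (f y)) x = star (cdir v (-w) f x) := by
  have h : HasFDerivAt (fun y => star (f y))
      ((Complex.conjCLE : ℂ →L[ℝ] ℂ).comp (fderiv ℝ f x)) x :=
    (Complex.conjCLE : ℂ →L[ℝ] ℂ).hasFDerivAt.comp x hf.hasFDerivAt
  simp only [cdir, h.fderiv]
  simp

end ConstantFields

/-- Real part of the constant complexified vector field `∂_k` on `ℂ²`. -/
def reDir : Fin 4 → Base := fun k =>
  (1 / 2 : ℝ) • ![((1, 0) : Base), (1, 0), (0, 1), (0, 1)] k

/-- Imaginary part of the constant complexified vector field `∂_k` on `ℂ²`. -/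
def imDir : Fin 4 → Base := fun k =>
  (![-(1 / 2), 1 / 2, -(1 / 2), 1 / 2] k : ℝ) •
    ![((Complex.I, 0) : Base), (Complex.I, 0), (0, Complex.I), (0, Complex.I)] k

theorem pd_eq_cdir (k : Fin 4) (f : Base → ℂ) : pd k f = cdir (reDir k) (imDir k) f := by
  funext x
  fin_cases k <;>
    simp only [pd, cdir, reDir, imDir, map_smul, Complex.real_smul] <;>
    simp [dHol, dAnti] <;> ring

theorem pdTotal_eq_cdir (k : Fin 4) (f : Total → ℂ) :
    pdTotal k f = cdir (reDir k, 0) (imDir k, 0) f := by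
  have h : ∀ (L : Total →L[ℝ] ℂ) (c : ℝ) (v : Base), L (c • v, 0) = c * L (v, 0) := by
    intro L c v
    rw [← Complex.real_smul, ← map_smul]
    congr 1
    ext <;> simp
  funext x
  fin_cases k <;>
    simp only [pdTotal, cdir, reDir, imDir, h] <;>
    simp [dHol, dAnti] <;> ring

theorem pdU_eq_cdir (f : Total → ℂ) : pdU f = cdir (0, 1) 0 f := by
  funext x; simp [pdU, cdir]

/-- The five derivatives `∂_k`, `∂_u` determine the differential. -/
theorem fderiv_total_apply (f : Total → ℂ) (p q : Total) :
    fderiv ℝ f p q = q.1.1 * pdTotal 0 f p + star q.1.1 * pdTotal 1 f p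
      + q.1.2 * pdTotal 2 f p + star q.1.2 * pdTotal 3 f p + q.2 * pdU f p := by
  obtain ⟨⟨z, w⟩, t⟩ := q
  have hq : (((z, w), t) : Total) = z.re • ((1, 0), 0) + z.im • ((Complex.I, 0), 0)
      + w.re • ((0, 1), 0) + w.im • ((0, Complex.I), 0) + t • (0, 1) := by
    ext <;> simp
  have hs : ∀ z : ℂ, star z = z.re - z.im * Complex.I := by
    intro z; apply Complex.ext <;> simp
  have hz := Complex.re_add_im z
  have hw := Complex.re_add_im w
  simp only [pdTotal, dHol, dAnti, pdU, Matrix.cons_val]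
  rw [hs, hs, hq]
  simp only [map_add, map_smul, Complex.real_smul]
  generalize fderiv ℝ f p ((1, 0), 0) = A
  generalize fderiv ℝ f p ((Complex.I, 0), 0) = B
  generalize fderiv ℝ f p ((0, 1), 0) = C
  generalize fderiv ℝ f p ((0, Complex.I), 0) = D
  generalize fderiv ℝ f p (0, 1) = K
  linear_combination (A - Complex.I * B) / 2 * hz + (C - Complex.I * D) / 2 * hw
    + (z.im * B + w.im * D) * Complex.I_mul_I

/-- Total derivative of a function of `(z¹, z², u)` along `u = u(z¹, z²)`. -/
theorem pd_comp_graph {f : Total → ℂ} {u : Base → ℝ} {x : Base} (k : Fin 4)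
    (hf : DifferentiableAt ℝ f (x, u x)) (hu : DifferentiableAt ℝ u x) :
    pd k (fun y => f (y, u y)) x
      = pdTotal k f (x, u x) + pdU f (x, u x) * pd k (fun y => (u y : ℂ)) x := by
  have h1 : HasFDerivAt (fun y => f (y, u y)) ((fderiv ℝ f (x, u x)).comp
      ((ContinuousLinearMap.id ℝ Base).prod (fderiv ℝ u x))) x :=
    HasFDerivAt.comp x hf.hasFDerivAt ((hasFDerivAt_id x).prodMk hu.hasFDerivAt)
  have h2 : HasFDerivAt (fun y => (u y : ℂ)) (Complex.ofRealCLM.comp (fderiv ℝ u x)) x :=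
    Complex.ofRealCLM.hasFDerivAt.comp x hu.hasFDerivAt
  have h3 : ∀ v : Base, ∀ t : ℝ, fderiv ℝ f (x, u x) (v, t)
      = fderiv ℝ f (x, u x) (v, 0) + t * fderiv ℝ f (x, u x) (0, 1) := by
    intro v t
    have : ((v, t) : Total) = (v, 0) + t • (0, 1) := by ext <;> simp
    rw [this, map_add, map_smul, Complex.real_smul]
  simp only [pd_eq_cdir, pdTotal_eq_cdir, pdU, cdir, h1.fderiv, h2.fderiv,
    ContinuousLinearMap.comp_apply, ContinuousLinearMap.prod_apply, ContinuousLinearMap.id_apply,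
    h3 _ (fderiv ℝ u x _), Complex.ofRealCLM_apply]
  ring

/-! ### The second prolongation -/

/-- The total derivative `D_i f` of a function of `(z¹, z², u)`, as a function of the first-order
jet with base point `p` and first derivatives `g`. -/
def totD (f : Total → ℂ) (p : Total) (g : Fin 4 → ℂ) (i : Fin 4) : ℂ :=
  pdTotal i f p + pdU f p * g i

/-- The part of the iterated total derivative `D_i D_j f` of a function of `(z¹, z², u)` that does
not involve second derivatives of `u`, as a function of the first-order jet. -/
def jetE (f : Total → ℂ) (p : Total) (g : Fin 4 → ℂ) (i j : Fin 4) : ℂ :=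
  pdTotal i (pdTotal j f) p + pdU (pdTotal j f) p * g i
    + (pdTotal i (pdU f) p + pdU (pdU f) p * g i) * g j

/-- The iterated total derivative `D_i D_j f` of a function of `(z¹, z², u)`, as a function of the
second-order jet with base point `p`, first derivatives `g` and second derivatives `h`. -/
def totDD (f : Total → ℂ) (p : Total) (g : Fin 4 → ℂ) (h : Fin 4 → Fin 4 → ℂ) (i j : Fin 4) : ℂ :=
  jetE f p g i j + pdU f p * h i j

/-- The coefficient `φ^{ij}` of the second prolongation, as a function of the second-order jet; the
third derivatives of `u` cancel. -/
def prolongJet (X : VField) (p : Total) (g : Fin 4 → ℂ) (h : Fin 4 → Fin 4 → ℂ) (i j : Fin 4) : ℂ :=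
  totDD (fun q => (X q).2) p g h i j
    - ∑ k, (totDD (fun q => (X q).1 k) p g h i j * g k
      + totD (fun q => (X q).1 k) p g j * h i k + totD (fun q => (X q).1 k) p g i * h j k)

theorem pdTotal_contDiffAt {f : Total → ℂ} {p : Total} (k : Fin 4) (hf : ContDiffAt ℝ ∞ f p) :
    ContDiffAt ℝ ∞ (pdTotal k f) p := by
  rw [pdTotal_eq_cdir]; exact cdir_contDiffAt hf

theorem pdU_contDiffAt {f : Total → ℂ} {p : Total} (hf : ContDiffAt ℝ ∞ f p) :
    ContDiffAt ℝ ∞ (pdU f) p := by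
  rw [pdU_eq_cdir]; exact cdir_contDiffAt hf

theorem pd_contDiffAt {f : Base → ℂ} {x : Base} (k : Fin 4) (hf : ContDiffAt ℝ ∞ f x) :
    ContDiffAt ℝ ∞ (pd k f) x := by
  rw [pd_eq_cdir]; exact cdir_contDiffAt hf

theorem pdTotal_comm {f : Total → ℂ} {p : Total} (i j : Fin 4) (hf : ContDiffAt ℝ ∞ f p) :
    pdTotal i (pdTotal j f) p = pdTotal j (pdTotal i f) p := by
  simp only [pdTotal_eq_cdir]; exact cdir_comm hf

theorem pdTotal_pdU_comm {f : Total → ℂ} {p : Total} (i : Fin 4) (hf : ContDiffAt ℝ ∞ f p) :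
    pdTotal i (pdU f) p = pdU (pdTotal i f) p := by
  simp only [pdTotal_eq_cdir, pdU_eq_cdir]; exact cdir_comm hf

theorem pd_comm {f : Base → ℂ} {x : Base} (i j : Fin 4) (hf : ContDiffAt ℝ ∞ f x) :
    pd i (pd j f) x = pd j (pd i f) x := by
  simp only [pd_eq_cdir]; exact cdir_comm hf

theorem pdTotal_congr {f g : Total → ℂ} {p : Total} (i : Fin 4) (h : f =ᶠ[nhds p] g) :
    pdTotal i f p = pdTotal i g p := by
  simp only [pdTotal_eq_cdir]; exact cdir_congr h

theorem pdU_congr {f g : Total → ℂ} {p : Total} (h : f =ᶠ[nhds p] g) : pdU f p = pdU g p := by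
  simp only [pdU_eq_cdir]; exact cdir_congr h

section Jet

variable {u : Base → ℝ} {x : Base}

theorem contDiffAt_ofReal_comp (hu : ContDiffAt ℝ ∞ u x) :
    ContDiffAt ℝ ∞ (fun y => (u y : ℂ)) x :=
  Complex.ofRealCLM.contDiff.contDiffAt.comp x hu

theorem contDiffAt_comp_graph {f : Total → ℂ} (hf : ContDiffAt ℝ ∞ f (x, u x))
    (hu : ContDiffAt ℝ ∞ u x) : ContDiffAt ℝ ∞ (fun y => f (y, u y)) x :=
  ContDiffAt.comp x hf (contDiffAt_id.prodMk hu)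

theorem eventually_differentiableAt_graph {f : Total → ℂ} (hf : ContDiffAt ℝ ∞ f (x, u x))
    (hu : ContDiff ℝ ∞ u) : ∀ᶠ y in nhds x, DifferentiableAt ℝ f (y, u y) := by
  have h1 : ∀ᶠ p in nhds (x, u x), ContDiffAt ℝ 1 f p :=
    (hf.of_le (by simp)).eventually (by simp)
  have h2 : Filter.Tendsto (fun y => (y, u y)) (nhds x) (nhds (x, u x)) :=
    (continuous_id.prodMk hu.continuous).continuousAt
  exact (h2.eventually h1).mono fun y hy => hy.differentiableAt (by simp)

theorem pd_pd_comp_graph {f : Total → ℂ} (i j : Fin 4) (hf : ContDiffAt ℝ ∞ f (x, u x))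
    (hu : ContDiff ℝ ∞ u) :
    pd i (pd j (fun y => f (y, u y))) x = totDD f (x, u x) (fun k => pd k (fun y => (u y : ℂ)) x)
      (hess (fun y => (u y : ℂ)) x) i j := by
  have hu' : ContDiffAt ℝ ∞ u x := hu.contDiffAt
  have hud : Differentiable ℝ u := hu.differentiable (by simp)
  have hj := (pdTotal_contDiffAt j hf)
  have hU := (pdU_contDiffAt hf)
  have hg := pd_contDiffAt j (contDiffAt_ofReal_comp hu')
  have h1 : pd j (fun y => f (y, u y)) =ᶠ[nhds x] fun y =>
      pdTotal j f (y, u y) + pdU f (y, u y) * pd j (fun y => (u y : ℂ)) y :=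
    (eventually_differentiableAt_graph hf hu).mono fun y hy => pd_comp_graph j hy (hud y)
  have n0 : (∞ : WithTop ℕ∞) ≠ 0 := by simp
  rw [pd_eq_cdir i, cdir_congr h1,
    cdir_add ((contDiffAt_comp_graph hj hu').differentiableAt n0)
      (((contDiffAt_comp_graph hU hu').differentiableAt n0).fun_mul (hg.differentiableAt n0)),
    cdir_mul ((contDiffAt_comp_graph hU hu').differentiableAt n0) (hg.differentiableAt n0),
    ← pd_eq_cdir, ← pd_eq_cdir, ← pd_eq_cdir,
    pd_comp_graph i (hj.differentiableAt n0) (hud x),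
    pd_comp_graph i (hU.differentiableAt n0) (hud x)]
  simp only [totDD, jetE, hess]
  ring

theorem prolong_eq_prolongJet {X : VField} (hX : ContDiffAt ℝ ∞ X (x, u x))
    (hu : ContDiff ℝ ∞ u) (i j : Fin 4) :
    prolong X u x i j = prolongJet X (x, u x) (fun k => pd k (fun y => (u y : ℂ)) x)
      (hess (fun y => (u y : ℂ)) x) i j := by
  have hu' : ContDiffAt ℝ ∞ u x := hu.contDiffAt
  have hud : Differentiable ℝ u := hu.differentiable (by simp)
  have n0 : (∞ : WithTop ℕ∞) ≠ 0 := by simp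
  have hξ : ∀ k, ContDiffAt ℝ ∞ (fun q => (X q).1 k) (x, u x) := contDiffAt_pi.1 hX.fst
  have hη : ContDiffAt ℝ ∞ (fun q => (X q).2) (x, u x) := hX.snd
  have hg : ∀ k y, ContDiffAt ℝ ∞ (pd k fun y => (u y : ℂ)) y := fun k y =>
    pd_contDiffAt k (contDiffAt_ofReal_comp hu.contDiffAt)
  have hgη := contDiffAt_comp_graph hη hu'
  have hgξ := fun k => contDiffAt_comp_graph (hξ k) hu'
  have hev : ∀ᶠ y in nhds x, DifferentiableAt ℝ (fun y => (X (y, u y)).2) y ∧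
      ∀ k, DifferentiableAt ℝ (fun y => (X (y, u y)).1 k) y := by
    refine ((eventually_differentiableAt_graph hη hu).and
      (Filter.eventually_all.2 fun k => eventually_differentiableAt_graph (hξ k) hu)).mono ?_
    rintro y ⟨h1, h2⟩
    have h3 : DifferentiableAt ℝ (fun y => (y, u y)) y := differentiableAt_id.prodMk (hud y)
    exact ⟨DifferentiableAt.comp (g := fun q => (X q).2) y h1 h3,
      fun k => DifferentiableAt.comp (g := fun q => (X q).1 k) y (h2 k) h3⟩
  -- the product rule for `∂_j (ξᵏ u_k)`, valid near `x`
  have h1 : pd j (characteristic X u) =ᶠ[nhds x] fun y => pd j (fun y => (X (y, u y)).2) y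
      - ∑ k, (pd j (fun y => (X (y, u y)).1 k) y * pd k (fun y => (u y : ℂ)) y
        + (X (y, u y)).1 k * pd j (pd k (fun y => (u y : ℂ))) y) := by
    refine hev.mono fun y hy => ?_
    have hgd := fun k => (hg k y).differentiableAt n0
    simp only [pd_eq_cdir j]
    unfold characteristic
    rw [cdir_sub hy.1 (DifferentiableAt.fun_sum fun k _ => (hy.2 k).fun_mul (hgd k)),
      cdir_sum _ (fun k _ => (hy.2 k).fun_mul (hgd k))]
    congr 1
    exact Finset.sum_congr rfl fun k _ => cdir_mul (hy.2 k) (hgd k)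
  have hd1 : ∀ k, DifferentiableAt ℝ
      (fun y => pd j (fun y => (X (y, u y)).1 k) y * pd k (fun y => (u y : ℂ)) y) x := fun k =>
    ((pd_contDiffAt j (hgξ k)).mul (hg k x)).differentiableAt n0
  have hd2 : ∀ k, DifferentiableAt ℝ
      (fun y => (X (y, u y)).1 k * pd j (pd k (fun y => (u y : ℂ))) y) x := fun k =>
    ((hgξ k).mul (pd_contDiffAt j (hg k x))).differentiableAt n0
  have h2 : pd i (pd j (characteristic X u)) x = pd i (pd j (fun y => (X (y, u y)).2)) x
      - ∑ k, (pd i (pd j (fun y => (X (y, u y)).1 k)) x * pd k (fun y => (u y : ℂ)) x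
        + pd j (fun y => (X (y, u y)).1 k) x * pd i (pd k (fun y => (u y : ℂ))) x
        + (pd i (fun y => (X (y, u y)).1 k) x * pd j (pd k (fun y => (u y : ℂ))) x
        + (X (x, u x)).1 k * pd i (pd j (pd k (fun y => (u y : ℂ)))) x)) := by
    simp only [pd_eq_cdir i]
    rw [cdir_congr h1, cdir_sub ((pd_contDiffAt j hgη).differentiableAt n0)
      (DifferentiableAt.fun_sum fun k _ => (hd1 k).fun_add (hd2 k)),
      cdir_sum _ (fun k _ => (hd1 k).fun_add (hd2 k))]
    congr 1
    refine Finset.sum_congr rfl fun k _ => ?_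
    rw [cdir_add (hd1 k) (hd2 k),
      cdir_mul ((pd_contDiffAt j (hgξ k)).differentiableAt n0) ((hg k x).differentiableAt n0),
      cdir_mul ((hgξ k).differentiableAt n0) ((pd_contDiffAt j (hg k x)).differentiableAt n0)]
  rw [prolong, h2, prolongJet, pd_pd_comp_graph i j hη hu, sub_add, ← Finset.sum_sub_distrib]
  congr 1
  refine Finset.sum_congr rfl fun k _ => ?_
  rw [pd_pd_comp_graph i j (hξ k) hu, pd_comp_graph i ((hξ k).differentiableAt n0) (hud x),
    pd_comp_graph j ((hξ k).differentiableAt n0) (hud x)]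
  simp only [totD, hess]
  ring

theorem lineDeriv_heavenly (δ : ℝ) (H φ : Fin 4 → Fin 4 → ℂ) :
    lineDeriv ℂ (heavenly δ) H φ =
      ((δ : ℂ) ^ 2 - 1) * (φ 0 1 * H 2 3 + H 0 1 * φ 2 3)
        - ((δ : ℂ) ^ 2 * (φ 0 2 * H 1 3 + H 0 2 * φ 1 3) - (φ 0 3 * H 2 1 + H 0 3 * φ 2 1)) := by
  apply HasLineDerivAt.lineDeriv
  unfold HasLineDerivAt
  -- `F` is a quadratic form, so `F (H + t φ)` is a quadratic polynomial in `t`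
  have h : (fun t : ℂ => heavenly δ (H + t • φ)) = fun t => heavenly δ H
      + t * (((δ : ℂ) ^ 2 - 1) * (φ 0 1 * H 2 3 + H 0 1 * φ 2 3)
        - ((δ : ℂ) ^ 2 * (φ 0 2 * H 1 3 + H 0 2 * φ 1 3) - (φ 0 3 * H 2 1 + H 0 3 * φ 2 1)))
      + t ^ 2 * heavenly δ φ := by
    funext t
    simp only [heavenly, Pi.add_apply, Pi.smul_apply, smul_eq_mul]
    ring
  rw [h]
  generalize ((δ : ℂ) ^ 2 - 1) * (φ 0 1 * H 2 3 + H 0 1 * φ 2 3)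
    - ((δ : ℂ) ^ 2 * (φ 0 2 * H 1 3 + H 0 2 * φ 1 3) - (φ 0 3 * H 2 1 + H 0 3 * φ 2 1)) = d
  simpa using (((hasDerivAt_id' (0 : ℂ)).mul_const d).const_add (heavenly δ H)).fun_add
    (((hasDerivAt_id' (0 : ℂ)).fun_pow 2).mul_const (heavenly δ φ))

end Jet

/-! ### Realizing second-order jets -/

/-- The real-linear coordinate functions `z¹, z̄¹, z², z̄²` on `ℂ²`. -/
def coord : Fin 4 → Base →L[ℝ] ℂ :=
  ![ContinuousLinearMap.fst ℝ ℂ ℂ,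
    (Complex.conjCLE : ℂ →L[ℝ] ℂ).comp (ContinuousLinearMap.fst ℝ ℂ ℂ),
    ContinuousLinearMap.snd ℝ ℂ ℂ,
    (Complex.conjCLE : ℂ →L[ℝ] ℂ).comp (ContinuousLinearMap.snd ℝ ℂ ℂ)]

theorem pd_coord (i k : Fin 4) (x y : Base) :
    pd i (fun y => coord k (y - x)) y = if i = k then 1 else 0 := by
  have h : fderiv ℝ (fun y => coord k (y - x)) y = coord k := by
    rw [fderiv_comp_sub (f := fun y => coord k y)]
    exact (coord k).fderiv
  rw [pd_eq_cdir, cdir, h]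
  fin_cases i <;> fin_cases k <;> apply Complex.ext <;>
    simp [coord, reDir, imDir] <;> norm_num

/-- First derivatives of a real function `u` with `u_1 = w₁`, `u_2 = w₂`. -/
def gradJet (w₁ w₂ : ℂ) : Fin 4 → ℂ := ![w₁, star w₁, w₂, star w₂]

/-- Second derivatives of a real function `u` with `u_{11} = α`, `u_{22} = β`, `u_{12} = q`,
`u_{12̄} = m`, `u_{11̄} = r`, `u_{22̄} = s`. -/
def hessJet (α β q m : ℂ) (r s : ℝ) : Fin 4 → Fin 4 → ℂ :=
  ![![α, r, q, m], ![r, star α, star m, star q], ![q, star m, β, s], ![m, star q, s, star β]]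

/-- Every real second-order jet is the jet of a quadratic polynomial. -/
theorem exists_jet (p : Total) (w₁ w₂ α β q m : ℂ) (r s : ℝ) :
    ∃ u : Base → ℝ, ContDiff ℝ ∞ u ∧ u p.1 = p.2 ∧
      (fun k => pd k (fun y => (u y : ℂ)) p.1) = gradJet w₁ w₂ ∧
      hess (fun y => (u y : ℂ)) p.1 = hessJet α β q m r s := by
  obtain ⟨x, u₀⟩ := p
  set g := gradJet w₁ w₂ with hg
  set h := hessJet α β q m r s with hh
  have hsymm : ∀ i j, h i j = h j i := by
    intro i j; fin_cases i <;> fin_cases j <;> simp [hh, hessJet]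
  let c : Fin 4 → Base → ℂ := fun k y => coord k (y - x)
  let P : Base → ℂ := fun y => u₀ + ∑ k, g k * c k y + ∑ k, ∑ l, h k l / 2 * (c k y * c l y)
  have hc : ∀ k, ContDiff ℝ ∞ (c k) := fun k =>
    (coord k).contDiff.comp (contDiff_id.sub contDiff_const)
  have hcd : ∀ k y, DifferentiableAt ℝ (c k) y := fun k y =>
    ((hc k).differentiable (by simp)).differentiableAt
  have hP : ContDiff ℝ ∞ P :=
    (contDiff_const.add (ContDiff.sum fun k _ => contDiff_const.mul (hc k))).add
      (ContDiff.sum fun k _ => ContDiff.sum fun l _ => contDiff_const.mul ((hc k).mul (hc l)))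
  have hreal : ∀ y, (((P y).re : ℝ) : ℂ) = P y := by
    intro y
    refine Complex.conj_eq_iff_re.1 ?_
    simp only [P, c, hg, hh, Fin.sum_univ_four, gradJet, hessJet, coord]
    simp [Complex.conj_ofNat]
    ring
  have hpd : ∀ j, pd j P = fun y => g j + ∑ l, h j l * c l y := by
    intro j
    funext y
    have hcj : ∀ k, cdir (reDir j) (imDir j) (c k) y = if j = k then 1 else 0 := fun k => by
      rw [← pd_eq_cdir]; exact pd_coord j k x y
    have d1 : ∀ k, DifferentiableAt ℝ (fun y => g k * c k y) y := fun k =>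
      (differentiableAt_const _).fun_mul (hcd k y)
    have d2 : ∀ k l, DifferentiableAt ℝ (fun y => h k l / 2 * (c k y * c l y)) y := fun k l =>
      (differentiableAt_const _).fun_mul ((hcd k y).fun_mul (hcd l y))
    have d3 : ∀ k, DifferentiableAt ℝ (fun y => ∑ l, h k l / 2 * (c k y * c l y)) y := fun k =>
      DifferentiableAt.fun_sum fun l _ => d2 k l
    rw [pd_eq_cdir, cdir_add ((differentiableAt_const _).fun_add
        (DifferentiableAt.fun_sum fun k _ => d1 k)) (DifferentiableAt.fun_sum fun k _ => d3 k),
      cdir_add (differentiableAt_const _) (DifferentiableAt.fun_sum fun k _ => d1 k),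
      cdir_const, cdir_sum _ fun k _ => d1 k, cdir_sum _ fun k _ => d3 k]
    have e1 : ∀ k, cdir (reDir j) (imDir j) (fun y => g k * c k y) y
        = if j = k then g k else 0 := fun k => by
      rw [cdir_mul (differentiableAt_const _) (hcd k y), cdir_const, hcj]; simp
    have e2 : ∀ k, cdir (reDir j) (imDir j) (fun y => ∑ l, h k l / 2 * (c k y * c l y)) y
        = ∑ l, h k l / 2 * ((if j = k then 1 else 0) * c l y
          + c k y * (if j = l then 1 else 0)) := fun k => by
      rw [cdir_sum _ fun l _ => d2 k l]
      refine Finset.sum_congr rfl fun l _ => ?_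
      rw [cdir_mul (differentiableAt_const _) ((hcd k y).fun_mul (hcd l y)), cdir_const,
        cdir_mul (hcd k y) (hcd l y), hcj, hcj]
      ring
    simp only [e1, e2, mul_add, Finset.sum_add_distrib]
    simp only [Finset.sum_ite_eq, Finset.mem_univ, if_true, ite_mul, mul_ite, zero_mul, one_mul,
      mul_zero, mul_one, zero_add]
    rw [Finset.sum_comm]
    simp only [Finset.sum_ite_eq, Finset.mem_univ, if_true]
    rw [← Finset.sum_add_distrib]
    congr 1
    refine Finset.sum_congr rfl fun l _ => ?_
    rw [hsymm l j]
    ring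
  have hpp : ∀ i j, pd i (pd j P) x = h i j := by
    intro i j
    have d1 : ∀ l, DifferentiableAt ℝ (fun y => h j l * c l y) x := fun l =>
      (differentiableAt_const _).fun_mul (hcd l x)
    rw [hpd, pd_eq_cdir, cdir_add (differentiableAt_const _)
      (DifferentiableAt.fun_sum fun l _ => d1 l), cdir_const, cdir_sum _ fun l _ => d1 l]
    have e1 : ∀ l, cdir (reDir i) (imDir i) (fun y => h j l * c l y) x
        = if i = l then h j l else 0 := fun l => by
      rw [cdir_mul (differentiableAt_const _) (hcd l x), cdir_const, ← pd_eq_cdir,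
        pd_coord i l x x]
      simp
    simp only [e1, Finset.sum_ite_eq, Finset.mem_univ, if_true, zero_add]
    exact hsymm j i
  have hc0 : ∀ k, c k x = 0 := fun k => by simp [c]
  refine ⟨fun y => (P y).re, Complex.reCLM.contDiff.comp hP, by simp [P, hc0], ?_, ?_⟩
  · funext k
    simp only [hreal]
    change pd k P x = g k
    simp [hpd, hc0]
  · funext i j
    simp only [hreal, hess]
    exact hpp i j

/-! ### The determining equations -/

/-- The determining equations of the point symmetries: `ξᵏ` depends on the `k`-th of the variables
`z¹, z̄¹, z², z̄²` only, and `η` is affine in `u` with locally constant slope and has no mixed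
derivatives.
They are linear and local, and do not involve `δ`. -/
structure Determining (U : Set Total) (X : VField) : Prop where
  smooth : ContDiffOn ℝ ∞ X U
  xi : ∀ p ∈ U, ∀ j k, j ≠ k → pdTotal j (fun q => (X q).1 k) p = 0
  xi_u : ∀ p ∈ U, ∀ k, pdU (fun q => (X q).1 k) p = 0
  eta_uu : ∀ p ∈ U, pdU (pdU fun q => (X q).2) p = 0
  eta_iu : ∀ p ∈ U, ∀ i, pdTotal i (pdU fun q => (X q).2) p = 0
  eta_ij : ∀ p ∈ U, ∀ i j, i ≠ j → pdTotal i (pdTotal j fun q => (X q).2) p = 0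

/-- The derivative of the quadratic form `heavenly δ` at `H` in the direction `φ`. -/
def polar (δ : ℝ) (H φ : Fin 4 → Fin 4 → ℂ) : ℂ :=
  ((δ : ℂ) ^ 2 - 1) * (φ 0 1 * H 2 3 + H 0 1 * φ 2 3)
    - ((δ : ℂ) ^ 2 * (φ 0 2 * H 1 3 + H 0 2 * φ 1 3) - (φ 0 3 * H 2 1 + H 0 3 * φ 2 1))

section

variable {δ : ℝ} {U : Set Total} {X : VField}

theorem contDiffAt_of_contDiffOn (hU : IsOpen U) (hX : ContDiffOn ℝ ∞ X U) {p : Total}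
    (hp : p ∈ U) : ContDiffAt ℝ ∞ X p := hX.contDiffAt (hU.mem_nhds hp)

theorem contDiffAt_xi {p : Total} (hX : ContDiffAt ℝ ∞ X p) (k : Fin 4) :
    ContDiffAt ℝ ∞ (fun q => (X q).1 k) p := contDiffAt_pi.1 hX.fst k

theorem IsPointSymmetry.polar_eq_zero (hU : IsOpen U) (h : IsPointSymmetry δ U X) {p : Total}
    (hp : p ∈ U) (w₁ w₂ α β q m : ℂ) (r s : ℝ) (hF : heavenly δ (hessJet α β q m r s) = 0) :
    polar δ (hessJet α β q m r s)
      (prolongJet X p (gradJet w₁ w₂) (hessJet α β q m r s)) = 0 := by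
  obtain ⟨u, hu, hu0, hg, hh⟩ := exists_jet p w₁ w₂ α β q m r s
  have hp' : (p.1, u p.1) = p := by rw [hu0]
  have := h.2 u hu p.1 (by rwa [hp']) (by rwa [hh])
  rw [lineDeriv_heavenly] at this
  have hX := contDiffAt_of_contDiffOn hU h.1 hp
  have e : prolong X u p.1 = prolongJet X p (gradJet w₁ w₂) (hessJet α β q m r s) := by
    funext i j
    rw [prolong_eq_prolongJet (by rwa [hp']) hu, hg, hh, hp']
  rwa [e, hh] at this

/-- The dependence of `φ^{ij}`, `i ≠ j`, on the diagonal second derivatives `u_{kk}`. -/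
theorem prolongJet_add_diag (p : Total) (g d : Fin 4 → ℂ) (h : Fin 4 → Fin 4 → ℂ) {i j : Fin 4}
    (hij : i ≠ j) :
    prolongJet X p g (fun i j => h i j + if i = j then d i else 0) i j = prolongJet X p g h i j
      - (totD (fun q => (X q).1 i) p g j * d i + totD (fun q => (X q).1 j) p g i * d j) := by
  simp only [prolongJet, totDD, if_neg hij, add_zero, mul_add, mul_ite, mul_zero,
    Finset.sum_add_distrib, Finset.sum_ite_eq, Finset.mem_univ, if_true]
  ring

theorem hessJet_eq_add_diag (α β q m : ℂ) (r s : ℝ) : hessJet α β q m r s =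
    fun i j => hessJet 0 0 q m r s i j + if i = j then ![α, star α, β, star β] i else 0 := by
  funext i j
  fin_cases i <;> fin_cases j <;> simp [hessJet]

theorem polar_prolongJet_hessJet (p : Total) (g : Fin 4 → ℂ) (α β q m : ℂ) (r s : ℝ) :
    polar δ (hessJet α β q m r s) (prolongJet X p g (hessJet α β q m r s)) =
      polar δ (hessJet 0 0 q m r s) (prolongJet X p g (hessJet 0 0 q m r s))
      - ((((δ : ℂ) ^ 2 - 1) * totD (fun q => (X q).1 0) p g 1 * s
        - (δ : ℂ) ^ 2 * totD (fun q => (X q).1 0) p g 2 * star q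
        + totD (fun q => (X q).1 0) p g 3 * star m) * α
      + (((δ : ℂ) ^ 2 - 1) * totD (fun q => (X q).1 1) p g 0 * s
        - (δ : ℂ) ^ 2 * totD (fun q => (X q).1 1) p g 3 * q
        + totD (fun q => (X q).1 1) p g 2 * m) * star α
      + (((δ : ℂ) ^ 2 - 1) * totD (fun q => (X q).1 2) p g 3 * r
        - (δ : ℂ) ^ 2 * totD (fun q => (X q).1 2) p g 0 * star q
        + totD (fun q => (X q).1 2) p g 1 * m) * β
      + (((δ : ℂ) ^ 2 - 1) * totD (fun q => (X q).1 3) p g 2 * r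
        - (δ : ℂ) ^ 2 * totD (fun q => (X q).1 3) p g 1 * q
        + totD (fun q => (X q).1 3) p g 0 * star m) * star β) := by
  have key := fun i j (hij : i ≠ j) =>
    prolongJet_add_diag (X := X) p g ![α, star α, β, star β] (hessJet 0 0 q m r s) hij
  rw [← hessJet_eq_add_diag] at key
  rw [polar, key 0 1 (by decide), key 2 3 (by decide), key 0 2 (by decide), key 1 3 (by decide),
    key 0 3 (by decide), key 2 1 (by decide), polar]
  generalize prolongJet X p g (hessJet 0 0 q m r s) = φ
  simp only [hessJet, Matrix.cons_val]
  ring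

theorem heavenly_hessJet (δ : ℝ) (α β q m : ℂ) (r s : ℝ) : heavenly δ (hessJet α β q m r s) =
    ((δ : ℂ) ^ 2 - 1) * (r * s) - ((δ : ℂ) ^ 2 * (q * star q) - m * star m) := by
  simp [heavenly, hessJet]

/-- `1`, `α`, `ᾱ`, `β`, `β̄` are linearly independent functions of `(α, β)`. -/
theorem coeff_eq_zero_of_forall {S P₀ P₁ P₂ P₃ : ℂ}
    (h : ∀ α β : ℂ, S - (P₀ * α + P₁ * star α + P₂ * β + P₃ * star β) = 0) :
    P₀ = 0 ∧ P₁ = 0 ∧ P₂ = 0 ∧ P₃ = 0 := by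
  have hI : star Complex.I = -Complex.I := Complex.conj_I
  -- from `P α + Q ᾱ = 0` for `α = 1, i` to `P = Q = 0`
  have key : ∀ P Q : ℂ, P + Q = 0 → Complex.I * (P - Q) = 0 → P = 0 ∧ Q = 0 := by
    intro P Q a b
    have b' : P - Q = 0 := (mul_eq_zero.1 b).resolve_left Complex.I_ne_zero
    exact ⟨by linear_combination (a + b') / 2, by linear_combination (a - b') / 2⟩
  have h0 := h 0 0
  have h1 := h 1 0
  have h2 := h Complex.I 0
  have h3 := h 0 1
  have h4 := h 0 Complex.I
  rw [star_zero] at h0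
  rw [star_zero, star_one] at h1 h3
  rw [star_zero, hI] at h2 h4
  obtain ⟨k0, k1⟩ := key P₀ P₁ (by linear_combination h0 - h1) (by linear_combination h0 - h2)
  obtain ⟨k2, k3⟩ := key P₂ P₃ (by linear_combination h0 - h3) (by linear_combination h0 - h4)
  exact ⟨k0, k1, k2, k3⟩

/-- As `F` does not involve `u_{11}` and `u_{22}`, the coefficients of `u_{11}`, `u_{1̄1̄}`, `u_{22}`
and `u_{2̄2̄}` in `pr⁽²⁾X (F)` vanish separately. -/
theorem IsPointSymmetry.totD_eq (hU : IsOpen U) (h : IsPointSymmetry δ U X) {p : Total}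
    (hp : p ∈ U) (w₁ w₂ q m : ℂ) (r s : ℝ) (hF : heavenly δ (hessJet 0 0 q m r s) = 0) :
    (((δ : ℂ) ^ 2 - 1) * totD (fun q => (X q).1 0) p (gradJet w₁ w₂) 1 * s
      - (δ : ℂ) ^ 2 * totD (fun q => (X q).1 0) p (gradJet w₁ w₂) 2 * star q
      + totD (fun q => (X q).1 0) p (gradJet w₁ w₂) 3 * star m = 0) ∧
    (((δ : ℂ) ^ 2 - 1) * totD (fun q => (X q).1 1) p (gradJet w₁ w₂) 0 * s
      - (δ : ℂ) ^ 2 * totD (fun q => (X q).1 1) p (gradJet w₁ w₂) 3 * q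
      + totD (fun q => (X q).1 1) p (gradJet w₁ w₂) 2 * m = 0) ∧
    (((δ : ℂ) ^ 2 - 1) * totD (fun q => (X q).1 2) p (gradJet w₁ w₂) 3 * r
      - (δ : ℂ) ^ 2 * totD (fun q => (X q).1 2) p (gradJet w₁ w₂) 0 * star q
      + totD (fun q => (X q).1 2) p (gradJet w₁ w₂) 1 * m = 0) ∧
    (((δ : ℂ) ^ 2 - 1) * totD (fun q => (X q).1 3) p (gradJet w₁ w₂) 2 * r
      - (δ : ℂ) ^ 2 * totD (fun q => (X q).1 3) p (gradJet w₁ w₂) 1 * q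
      + totD (fun q => (X q).1 3) p (gradJet w₁ w₂) 0 * star m = 0) := by
  refine coeff_eq_zero_of_forall (S := polar δ (hessJet 0 0 q m r s)
    (prolongJet X p (gradJet w₁ w₂) (hessJet 0 0 q m r s))) fun α β => ?_
  rw [← polar_prolongJet_hessJet]
  exact h.polar_eq_zero hU hp w₁ w₂ α β q m r s (by rw [heavenly_hessJet] at hF ⊢; exact hF)

theorem sq_sub_one_ne_zero (hδ : 0 < δ) (hδ1 : δ ≠ 1) : (δ : ℂ) ^ 2 - 1 ≠ 0 := by
  have : δ ^ 2 - 1 ≠ 0 := by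
    intro h
    have : (δ - 1) * (δ + 1) = 0 := by linear_combination h
    rcases mul_eq_zero.1 this with h | h
    · exact hδ1 (by linarith)
    · linarith
  exact_mod_cast this

theorem IsPointSymmetry.totD_eq_zero (hδ : 0 < δ) (hδ1 : δ ≠ 1) (hU : IsOpen U)
    (h : IsPointSymmetry δ U X) {p : Total} (hp : p ∈ U) (w₁ w₂ : ℂ) {j k : Fin 4} (hjk : j ≠ k) :
    totD (fun q => (X q).1 k) p (gradJet w₁ w₂) j = 0 := by
  have hA := sq_sub_one_ne_zero hδ hδ1
  have hB : (δ : ℂ) ≠ 0 := by exact_mod_cast hδ.ne'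
  have e1 := h.totD_eq hU hp w₁ w₂ 0 0 0 1 (by simp [heavenly_hessJet])
  have e2 := h.totD_eq hU hp w₁ w₂ 0 0 1 0 (by simp [heavenly_hessJet])
  -- with `r = s = 0` the equation is `δ² |q|² = |m|²`
  have e3 := h.totD_eq hU hp w₁ w₂ 1 δ 0 0 (by simp [heavenly_hessJet]; ring)
  have e4 := h.totD_eq hU hp w₁ w₂ 1 (-δ) 0 0 (by simp [heavenly_hessJet]; ring)
  generalize gradJet w₁ w₂ = g at *
  have split : ∀ a b : ℂ, -((δ : ℂ) ^ 2 * a) + b * δ = 0 → -((δ : ℂ) ^ 2 * a) + b * -δ = 0 →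
      a = 0 ∧ b = 0 := by
    intro a b h1 h2
    constructor
    · refine (mul_eq_zero.1 (?_ : (δ : ℂ) ^ 2 * a = 0)).resolve_left (pow_ne_zero 2 hB)
      linear_combination -(h1 + h2) / 2
    · refine (mul_eq_zero.1 (?_ : (δ : ℂ) * b = 0)).resolve_left hB
      linear_combination (h1 - h2) / 2
  simp [hA] at e1 e2 e3 e4
  obtain ⟨a2, a3⟩ := split _ _ e3.1 (by simpa using e4.1)
  obtain ⟨b3, b2⟩ := split _ _ e3.2.1 (by simpa using e4.2.1)
  obtain ⟨c0, c1⟩ := split _ _ e3.2.2.1 (by simpa using e4.2.2.1)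
  obtain ⟨d1, d0⟩ := split _ _ e3.2.2.2 (by simpa using e4.2.2.2)
  obtain ⟨a1, b0⟩ := e1
  obtain ⟨c3, d2⟩ := e2
  fin_cases j <;> fin_cases k <;> first | exact absurd rfl hjk | assumption

theorem IsPointSymmetry.xi_eq_zero (hδ : 0 < δ) (hδ1 : δ ≠ 1) (hU : IsOpen U)
    (h : IsPointSymmetry δ U X) {p : Total} (hp : p ∈ U) (k : Fin 4) :
    (∀ j, j ≠ k → pdTotal j (fun q => (X q).1 k) p = 0) ∧ pdU (fun q => (X q).1 k) p = 0 := by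
  have h0 : ∀ j, j ≠ k → pdTotal j (fun q => (X q).1 k) p = 0 := fun j hj => by
    have := h.totD_eq_zero hδ hδ1 hU hp 0 0 hj
    have hg : gradJet 0 0 j = 0 := by fin_cases j <;> simp [gradJet]
    simpa [totD, hg] using this
  refine ⟨h0, ?_⟩
  obtain ⟨j, hj⟩ := exists_ne k
  have := h.totD_eq_zero hδ hδ1 hU hp 1 1 hj
  have hg : gradJet 1 1 j = 1 := by fin_cases j <;> simp [gradJet]
  simpa [totD, hg, h0 j hj] using this

/-- The coefficients of the second prolongation when `ξᵏ` depends on the `k`-th variable only. -/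
theorem prolongJet_of_xi (hU : IsOpen U) (hX : ContDiffOn ℝ ∞ X U)
    (hξ : ∀ p ∈ U, ∀ j k, j ≠ k → pdTotal j (fun q => (X q).1 k) p = 0)
    (hξu : ∀ p ∈ U, ∀ k, pdU (fun q => (X q).1 k) p = 0) {p : Total} (hp : p ∈ U)
    (g : Fin 4 → ℂ) {h : Fin 4 → Fin 4 → ℂ} (hs : ∀ i j, h i j = h j i) {i j : Fin 4}
    (hij : i ≠ j) :
    prolongJet X p g h i j = jetE (fun q => (X q).2) p g i j
      + (pdU (fun q => (X q).2) p - pdTotal i (fun q => (X q).1 i) p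
        - pdTotal j (fun q => (X q).1 j) p) * h i j := by
  have hX' := contDiffAt_of_contDiffOn hU hX hp
  have hd : ∀ i f, (∀ q ∈ U, f q = 0) → pdTotal i f p = 0 := fun i f hf => by
    rw [pdTotal_congr i (g := fun _ => 0) (Filter.eventually_of_mem (hU.mem_nhds hp) hf),
      pdTotal_eq_cdir, cdir_const]
  have hdU : ∀ f, (∀ q ∈ U, f q = 0) → pdU f p = 0 := fun f hf => by
    rw [pdU_congr (g := fun _ => 0) (Filter.eventually_of_mem (hU.mem_nhds hp) hf),
      pdU_eq_cdir, cdir_const]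
  have hE : ∀ k, jetE (fun q => (X q).1 k) p g i j = 0 := by
    intro k
    have h1 : pdTotal i (pdTotal j fun q => (X q).1 k) p = 0 := by
      by_cases hjk : j = k
      · rw [pdTotal_comm i j (contDiffAt_xi hX' k)]
        exact hd j _ fun q hq => hξ q hq i k (hjk ▸ hij)
      · exact hd i _ fun q hq => hξ q hq j k hjk
    have h2 : pdU (pdTotal j fun q => (X q).1 k) p = 0 := by
      rw [← pdTotal_pdU_comm j (contDiffAt_xi hX' k)]
      exact hd j _ fun q hq => hξu q hq k
    rw [jetE, h1, h2, hd i _ fun q hq => hξu q hq k, hdU _ fun q hq => hξu q hq k]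
    ring
  have hT : ∀ l, ∑ k, totD (fun q => (X q).1 k) p g l * h k i
      = pdTotal l (fun q => (X q).1 l) p * h l i ∧
      ∑ k, totD (fun q => (X q).1 k) p g l * h k j
      = pdTotal l (fun q => (X q).1 l) p * h l j := by
    intro l
    constructor <;>
    · rw [Finset.sum_eq_single l]
      · rw [totD, hξu p hp, zero_mul, add_zero]
      · intro k _ hk
        rw [totD, hξ p hp l k hk.symm, hξu p hp]; ring
      · simp
  have hsum : ∑ k, (totDD (fun q => (X q).1 k) p g h i j * g k
      + totD (fun q => (X q).1 k) p g j * h i k + totD (fun q => (X q).1 k) p g i * h j k)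
      = pdTotal j (fun q => (X q).1 j) p * h j i + pdTotal i (fun q => (X q).1 i) p * h i j := by
    rw [← (hT j).1, ← (hT i).2, ← Finset.sum_add_distrib]
    refine Finset.sum_congr rfl fun k _ => ?_
    rw [totDD, hE, hξu p hp, hs i k, hs j k]; ring
  rw [prolongJet, hsum, totDD, hs j i]
  ring

/-- When `ξᵏ` depends on the `k`-th variable only, `pr⁽²⁾X (F)` is a multiple of `F`, up to the
contribution of the derivatives of `η` other than `η_u`. -/
theorem polar_prolongJet_of_xi (hU : IsOpen U) (hX : ContDiffOn ℝ ∞ X U)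
    (hξ : ∀ p ∈ U, ∀ j k, j ≠ k → pdTotal j (fun q => (X q).1 k) p = 0)
    (hξu : ∀ p ∈ U, ∀ k, pdU (fun q => (X q).1 k) p = 0) {p : Total} (hp : p ∈ U)
    (g : Fin 4 → ℂ) {h : Fin 4 → Fin 4 → ℂ} (hs : ∀ i j, h i j = h j i) :
    polar δ h (prolongJet X p g h) = polar δ h (jetE (fun q => (X q).2) p g)
      + (2 * pdU (fun q => (X q).2) p - ∑ i, pdTotal i (fun q => (X q).1 i) p)
        * heavenly δ h := by
  have key := fun i j (hij : i ≠ j) => prolongJet_of_xi hU hX hξ hξu hp g hs hij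
  rw [polar, key 0 1 (by decide), key 2 3 (by decide), key 0 2 (by decide), key 1 3 (by decide),
    key 0 3 (by decide), key 2 1 (by decide), Fin.sum_univ_four, heavenly, polar]
  ring

theorem hess_symm {u : Base → ℝ} (hu : ContDiff ℝ ∞ u) (x : Base) (i j : Fin 4) :
    hess (fun y => (u y : ℂ)) x i j = hess (fun y => (u y : ℂ)) x j i :=
  pd_comm i j (contDiffAt_ofReal_comp hu.contDiffAt)

theorem hessJet_symm (α β q m : ℂ) (r s : ℝ) (i j : Fin 4) :
    hessJet α β q m r s i j = hessJet α β q m r s j i := by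
  fin_cases i <;> fin_cases j <;> simp [hessJet]

theorem jetE_symm {f : Total → ℂ} {p : Total} (hf : ContDiffAt ℝ ∞ f p) (g : Fin 4 → ℂ)
    (i j : Fin 4) : jetE f p g i j = jetE f p g j i := by
  simp only [jetE, pdTotal_comm i j hf, pdTotal_pdU_comm _ hf]; ring

/-- The real points of the cone `F = 0` span the space of the off-diagonal second derivatives, so a
covector vanishing on it is zero. -/
theorem eq_zero_of_polar (hδ : 0 < δ) (hδ1 : δ ≠ 1) {E : Fin 4 → Fin 4 → ℂ}
    (hE : ∀ i j, E i j = E j i)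
    (h : ∀ (q m : ℂ) (r s : ℝ), heavenly δ (hessJet 0 0 q m r s) = 0 →
      polar δ (hessJet 0 0 q m r s) E = 0) {i j : Fin 4} (hij : i ≠ j) : E i j = 0 := by
  have hA := sq_sub_one_ne_zero hδ hδ1
  have hB : (δ : ℂ) ≠ 0 := by exact_mod_cast hδ.ne'
  have hII := Complex.I_mul_I
  have e1 := h 0 0 0 1 (by simp [heavenly_hessJet])
  have e2 := h 0 0 1 0 (by simp [heavenly_hessJet])
  -- with `r = s = 0` the equation is `δ² |q|² = |m|²`
  have e3 := h 1 δ 0 0 (by simp [heavenly_hessJet]; ring)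
  have e4 := h 1 (-δ) 0 0 (by simp [heavenly_hessJet]; ring)
  have e5 := h Complex.I δ 0 0 (by simp [heavenly_hessJet]; ring)
  have e6 := h 1 (Complex.I * δ) 0 0 (by simp [heavenly_hessJet]; linear_combination -δ ^ 2 * hII)
  simp [polar, hessJet, hA] at e1 e2 e3 e4 e5 e6
  have s1 : E 0 2 + E 1 3 = 0 := by
    refine (mul_eq_zero.1 (?_ : (δ : ℂ) ^ 2 * _ = 0)).resolve_left (pow_ne_zero 2 hB)
    linear_combination -(e3 + e4) / 2
  have s2 : E 0 3 + E 2 1 = 0 := by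
    refine (mul_eq_zero.1 (?_ : (δ : ℂ) * _ = 0)).resolve_left hB
    linear_combination (e3 - e4) / 2
  have s3 : E 1 3 - E 0 2 = 0 := by
    refine (mul_eq_zero.1 (?_ : (δ : ℂ) ^ 2 * Complex.I * _ = 0)).resolve_left
      (mul_ne_zero (pow_ne_zero 2 hB) Complex.I_ne_zero)
    linear_combination -e5 + δ * s2
  have s4 : E 2 1 - E 0 3 = 0 := by
    refine (mul_eq_zero.1 (?_ : (δ : ℂ) * Complex.I * _ = 0)).resolve_left
      (mul_ne_zero hB Complex.I_ne_zero)
    linear_combination e6 + δ ^ 2 * s1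
  have t02 : E 0 2 = 0 := by linear_combination (s1 - s3) / 2
  have t13 : E 1 3 = 0 := by linear_combination (s1 + s3) / 2
  have t03 : E 0 3 = 0 := by linear_combination (s2 - s4) / 2
  have t21 : E 2 1 = 0 := by linear_combination (s2 + s4) / 2
  fin_cases i <;> fin_cases j <;> first | exact absurd rfl hij | assumption | (rw [hE]; assumption)

theorem IsPointSymmetry.determining (hδ : 0 < δ) (hδ1 : δ ≠ 1) (hU : IsOpen U)
    (h : IsPointSymmetry δ U X) : Determining U X := by
  have hξ : ∀ p ∈ U, ∀ j k, j ≠ k → pdTotal j (fun q => (X q).1 k) p = 0 :=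
    fun p hp j k hjk => (h.xi_eq_zero hδ hδ1 hU hp k).1 j hjk
  have hξu : ∀ p ∈ U, ∀ k, pdU (fun q => (X q).1 k) p = 0 :=
    fun p hp k => (h.xi_eq_zero hδ hδ1 hU hp k).2
  have hη : ∀ p ∈ U, ContDiffAt ℝ ∞ (fun q => (X q).2) p := fun p hp =>
    (contDiffAt_of_contDiffOn hU h.1 hp).snd
  have hE : ∀ p ∈ U, ∀ w₁ w₂ : ℂ, ∀ i j, i ≠ j →
      jetE (fun q => (X q).2) p (gradJet w₁ w₂) i j = 0 := by
    intro p hp w₁ w₂ i j hij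
    refine eq_zero_of_polar hδ hδ1 (jetE_symm (hη p hp) _) (fun q m r s hF => ?_) hij
    have := h.polar_eq_zero hU hp w₁ w₂ 0 0 q m r s hF
    rwa [polar_prolongJet_of_xi hU h.1 hξ hξu hp _ (hessJet_symm 0 0 q m r s), hF, mul_zero,
      add_zero] at this
  have hij : ∀ p ∈ U, ∀ i j, i ≠ j → pdTotal i (pdTotal j fun q => (X q).2) p = 0 := by
    intro p hp i j hij
    have hg : ∀ i, gradJet 0 0 i = 0 := by intro i; fin_cases i <;> simp [gradJet]
    simpa [jetE, hg] using hE p hp 0 0 i j hij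
  -- if `b w + a w̄ + e |w|²` vanishes at `w = 1, -1, i`, then `a = b = e = 0`
  have key : ∀ b a e : ℂ, b + (a + e) = 0 → -b + -(a + -e) = 0 →
      b * Complex.I + -((a + e * Complex.I) * Complex.I) = 0 → a = 0 ∧ b = 0 ∧ e = 0 := by
    intro b a e h1 h2 h3
    have he : e = 0 := by linear_combination (h1 + h2) / 2
    subst he
    have h4 : b - a = 0 := (mul_eq_zero.1 (by linear_combination h3 :
      Complex.I * (b - a) = 0)).resolve_left Complex.I_ne_zero
    exact ⟨by linear_combination (h1 - h4) / 2, by linear_combination (h1 + h4) / 2, rfl⟩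
  have h01 : ∀ p ∈ U, pdTotal 0 (pdU fun q => (X q).2) p = 0 ∧
      pdU (pdTotal 1 fun q => (X q).2) p = 0 ∧ pdU (pdU fun q => (X q).2) p = 0 := by
    intro p hp
    have e1 := hE p hp 1 0 0 1 (by decide)
    have e2 := hE p hp (-1) 0 0 1 (by decide)
    have e3 := hE p hp Complex.I 0 0 1 (by decide)
    simp [jetE, gradJet, hij p hp 0 1 (by decide)] at e1 e2 e3
    exact key _ _ _ (by linear_combination e1) (by linear_combination e2)
      (by linear_combination e3)
  have h23 : ∀ p ∈ U, pdTotal 2 (pdU fun q => (X q).2) p = 0 ∧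
      pdU (pdTotal 3 fun q => (X q).2) p = 0 ∧ pdU (pdU fun q => (X q).2) p = 0 := by
    intro p hp
    have e1 := hE p hp 0 1 2 3 (by decide)
    have e2 := hE p hp 0 (-1) 2 3 (by decide)
    have e3 := hE p hp 0 Complex.I 2 3 (by decide)
    simp [jetE, gradJet, hij p hp 2 3 (by decide)] at e1 e2 e3
    exact key _ _ _ (by linear_combination e1) (by linear_combination e2)
      (by linear_combination e3)
  refine ⟨h.1, hξ, hξu, fun p hp => (h01 p hp).2.2, fun p hp i => ?_, hij⟩
  fin_cases i
  · exact (h01 p hp).1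
  · exact (pdTotal_pdU_comm 1 (hη p hp)).trans (h01 p hp).2.1
  · exact (h23 p hp).1
  · exact (pdTotal_pdU_comm 3 (hη p hp)).trans (h23 p hp).2.1

theorem Determining.isPointSymmetry (hU : IsOpen U) (h : Determining U X) :
    IsPointSymmetry δ U X := by
  refine ⟨h.smooth, fun u hu x hx hF => ?_⟩
  have hX := contDiffAt_of_contDiffOn hU h.smooth hx
  have e : prolong X u x = prolongJet X (x, u x) (fun k => pd k (fun y => (u y : ℂ)) x)
      (hess (fun y => (u y : ℂ)) x) := by
    funext i j; exact prolong_eq_prolongJet hX hu i j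
  have hE : ∀ i j, i ≠ j → jetE (fun q => (X q).2) (x, u x)
      (fun k => pd k (fun y => (u y : ℂ)) x) i j = 0 := by
    intro i j hij
    rw [jetE, h.eta_ij _ hx i j hij, ← pdTotal_pdU_comm j hX.snd, h.eta_iu _ hx, h.eta_iu _ hx,
      h.eta_uu _ hx]
    ring
  rw [lineDeriv_heavenly, e]
  refine (polar_prolongJet_of_xi hU h.smooth h.xi h.xi_u hx _ (hess_symm hu x)).trans ?_
  rw [hF, polar, hE 0 1 (by decide), hE 2 3 (by decide), hE 0 2 (by decide), hE 1 3 (by decide),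
    hE 0 3 (by decide), hE 2 1 (by decide)]
  ring

end

/-! ### The general combination of the generators -/

/-- The `∂_u`-component `k u + c(z¹) + c̄'(z̄¹) + d(z²) + d̄'(z̄²)` of a combination of generators. -/
def etaForm (c c' d d' : ℂ → ℂ) (k : ℂ) : Total → ℂ := fun p =>
  k * p.2 + c p.1.1 + star (c' p.1.1) + d p.1.2 + star (d' p.1.2)

/-- The general complex combination of the generators; primed functions occur conjugated. -/
def normalForm (a a' b b' c c' d d' : ℂ → ℂ) (k : ℂ) : VField := fun p =>
  (![a p.1.1, star (a' p.1.1), b p.1.2, star (b' p.1.2)], etaForm c c' d d' k p)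

/-- On `U`, the vector field is a combination `normalForm` of the generators with holomorphic
coefficient functions. -/
def HasNormalForm (U : Set Total) (X : VField) : Prop :=
  ∃ (a a' b b' c c' d d' : ℂ → ℂ) (k : ℂ), (Hol₁ U a ∧ Hol₁ U a' ∧ Hol₂ U b ∧ Hol₂ U b') ∧
    (Hol₁ U c ∧ Hol₁ U c' ∧ Hol₂ U d ∧ Hol₂ U d') ∧
    EqOn X (normalForm a a' b b' c c' d d' k) U

theorem normalForm_eq_sum (a a' b b' c c' d d' : ℂ → ℂ) (k : ℂ) :
    normalForm a a' b b' c c' d d' k = X₁ a + X₁bar a' + X₂ b + X₂bar b' + k • X₃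
      + X₄ c + X₄bar c' + X₅ d + X₅bar d' := by
  funext p
  refine Prod.ext (funext fun i => ?_) ?_
  · fin_cases i <;>
      simp [normalForm, X₁, X₁bar, X₂, X₂bar, X₃, X₄, X₄bar, X₅, X₅bar, horizontal, vertical]
  · simp [normalForm, etaForm, X₁, X₁bar, X₂, X₂bar, X₃, X₄, X₄bar, X₅, X₅bar, horizontal,
      vertical]

theorem normalForm_add (a₁ a₁' b₁ b₁' c₁ c₁' d₁ d₁' a₂ a₂' b₂ b₂' c₂ c₂' d₂ d₂' : ℂ → ℂ)
    (k₁ k₂ : ℂ) :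
    normalForm a₁ a₁' b₁ b₁' c₁ c₁' d₁ d₁' k₁ + normalForm a₂ a₂' b₂ b₂' c₂ c₂' d₂ d₂' k₂ =
      normalForm (fun z => a₁ z + a₂ z) (fun z => a₁' z + a₂' z) (fun z => b₁ z + b₂ z)
        (fun z => b₁' z + b₂' z) (fun z => c₁ z + c₂ z) (fun z => c₁' z + c₂' z)
        (fun z => d₁ z + d₂ z) (fun z => d₁' z + d₂' z) (k₁ + k₂) := by
  funext p
  refine Prod.ext (funext fun i => ?_) ?_
  · fin_cases i <;> simp [normalForm]
  · simp [normalForm, etaForm]; ring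

theorem smul_normalForm (t : ℂ) (a a' b b' c c' d d' : ℂ → ℂ) (k : ℂ) :
    t • normalForm a a' b b' c c' d d' k =
      normalForm (fun z => t * a z) (fun z => star t * a' z) (fun z => t * b z)
        (fun z => star t * b' z) (fun z => t * c z) (fun z => star t * c' z)
        (fun z => t * d z) (fun z => star t * d' z) (t * k) := by
  funext p
  refine Prod.ext (funext fun i => ?_) ?_
  · fin_cases i <;> simp [normalForm]
  · simp [normalForm, etaForm]; ring

theorem hol₁_const (U : Set Total) (t : ℂ) : Hol₁ U fun _ => t := differentiableOn_const t

theorem hol₂_const (U : Set Total) (t : ℂ) : Hol₂ U fun _ => t := differentiableOn_const t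

theorem IsGenerator.hasNormalForm {U : Set Total} {Z : VField} (h : IsGenerator U Z) :
    HasNormalForm U Z := by
  have h₁ := hol₁_const U 0
  have h₂ := hol₂_const U 0
  cases h with
  | x1 a h => exact ⟨a, _, _, _, _, _, _, _, 0, ⟨h, h₁, h₂, h₂⟩, ⟨h₁, h₁, h₂, h₂⟩, fun p _ => by
      simp [normalForm_eq_sum, X₁, X₁bar, X₂, X₂bar, X₄, X₄bar, X₅, X₅bar, horizontal, vertical]⟩
  | x1bar a h => exact ⟨_, a, _, _, _, _, _, _, 0, ⟨h₁, h, h₂, h₂⟩, ⟨h₁, h₁, h₂, h₂⟩, fun p _ => by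
      simp [normalForm_eq_sum, X₁, X₁bar, X₂, X₂bar, X₄, X₄bar, X₅, X₅bar, horizontal, vertical]⟩
  | x2 b h => exact ⟨_, _, b, _, _, _, _, _, 0, ⟨h₁, h₁, h, h₂⟩, ⟨h₁, h₁, h₂, h₂⟩, fun p _ => by
      simp [normalForm_eq_sum, X₁, X₁bar, X₂, X₂bar, X₄, X₄bar, X₅, X₅bar, horizontal, vertical]⟩
  | x2bar b h => exact ⟨_, _, _, b, _, _, _, _, 0, ⟨h₁, h₁, h₂, h⟩, ⟨h₁, h₁, h₂, h₂⟩, fun p _ => by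
      simp [normalForm_eq_sum, X₁, X₁bar, X₂, X₂bar, X₄, X₄bar, X₅, X₅bar, horizontal, vertical]⟩
  | x3 => exact ⟨_, _, _, _, _, _, _, _, 1, ⟨h₁, h₁, h₂, h₂⟩, ⟨h₁, h₁, h₂, h₂⟩, fun p _ => by
      simp [Prod.ext_iff, normalForm_eq_sum, X₁, X₁bar, X₂, X₂bar, X₄, X₄bar, X₅, X₅bar, horizontal,
        vertical]⟩
  | x4 c h => exact ⟨_, _, _, _, c, _, _, _, 0, ⟨h₁, h₁, h₂, h₂⟩, ⟨h, h₁, h₂, h₂⟩, fun p _ => by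
      simp [normalForm_eq_sum, X₁, X₁bar, X₂, X₂bar, X₄, X₄bar, X₅, X₅bar, horizontal, vertical]⟩
  | x4bar c h => exact ⟨_, _, _, _, _, c, _, _, 0, ⟨h₁, h₁, h₂, h₂⟩, ⟨h₁, h, h₂, h₂⟩, fun p _ => by
      simp [normalForm_eq_sum, X₁, X₁bar, X₂, X₂bar, X₄, X₄bar, X₅, X₅bar, horizontal, vertical]⟩
  | x5 d h => exact ⟨_, _, _, _, _, _, d, _, 0, ⟨h₁, h₁, h₂, h₂⟩, ⟨h₁, h₁, h, h₂⟩, fun p _ => by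
      simp [normalForm_eq_sum, X₁, X₁bar, X₂, X₂bar, X₄, X₄bar, X₅, X₅bar, horizontal, vertical]⟩
  | x5bar d h => exact ⟨_, _, _, _, _, _, _, d, 0, ⟨h₁, h₁, h₂, h₂⟩, ⟨h₁, h₁, h₂, h⟩, fun p _ => by
      simp [normalForm_eq_sum, X₁, X₁bar, X₂, X₂bar, X₄, X₄bar, X₅, X₅bar, horizontal, vertical]⟩

theorem isGenerated_iff_hasNormalForm {U : Set Total} {X : VField} :
    IsGenerated U X ↔ HasNormalForm U X := by
  constructor
  · rintro ⟨Y, hY, hXY⟩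
    suffices h : HasNormalForm U Y by
      obtain ⟨a, a', b, b', c, c', d, d', k, h1, h2, h⟩ := h
      exact ⟨a, a', b, b', c, c', d, d', k, h1, h2, hXY.trans h⟩
    clear hXY
    induction hY using Submodule.span_induction with
    | mem Z hZ => exact IsGenerator.hasNormalForm hZ
    | zero =>
      have h₁ := hol₁_const U 0
      have h₂ := hol₂_const U 0
      exact ⟨_, _, _, _, _, _, _, _, 0, ⟨h₁, h₁, h₂, h₂⟩, ⟨h₁, h₁, h₂, h₂⟩, fun p _ => by
        simp [Prod.ext_iff, normalForm_eq_sum, X₁, X₁bar, X₂, X₂bar, X₄, X₄bar, X₅, X₅bar,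
          horizontal, vertical]⟩
    | add Y Z _ _ hY hZ =>
      obtain ⟨a, a', b, b', c, c', d, d', k, h1, h2, h⟩ := hY
      obtain ⟨a₂, a₂', b₂, b₂', c₂, c₂', d₂, d₂', k₂, i1, i2, i⟩ := hZ
      refine ⟨_, _, _, _, _, _, _, _, k + k₂,
        ⟨h1.1.fun_add i1.1, h1.2.1.fun_add i1.2.1, h1.2.2.1.fun_add i1.2.2.1,
          h1.2.2.2.fun_add i1.2.2.2⟩,
        ⟨h2.1.fun_add i2.1, h2.2.1.fun_add i2.2.1, h2.2.2.1.fun_add i2.2.2.1,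
          h2.2.2.2.fun_add i2.2.2.2⟩, fun p hp => ?_⟩
      rw [← normalForm_add, Pi.add_apply, Pi.add_apply, h hp, i hp]
    | smul t Y _ hY =>
      obtain ⟨a, a', b, b', c, c', d, d', k, h1, h2, h⟩ := hY
      refine ⟨_, _, _, _, _, _, _, _, t * k,
        ⟨h1.1.const_mul t, h1.2.1.const_mul (star t), h1.2.2.1.const_mul t,
          h1.2.2.2.const_mul (star t)⟩,
        ⟨h2.1.const_mul t, h2.2.1.const_mul (star t), h2.2.2.1.const_mul t,
          h2.2.2.2.const_mul (star t)⟩, fun p hp => ?_⟩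
      rw [← smul_normalForm, Pi.smul_apply, Pi.smul_apply, h hp]
  · rintro ⟨a, a', b, b', c, c', d, d', k, ⟨ha, ha', hb, hb'⟩, ⟨hc, hc', hd, hd'⟩, h⟩
    refine ⟨_, ?_, h⟩
    have mem : ∀ {Z}, IsGenerator U Z → Z ∈ Submodule.span ℂ {Z : VField | IsGenerator U Z} :=
      fun h => Submodule.subset_span h
    rw [normalForm_eq_sum]
    refine add_mem (add_mem (add_mem (add_mem (add_mem (add_mem (add_mem (add_mem ?_ ?_) ?_) ?_)
      (Submodule.smul_mem _ k (mem .x3))) ?_) ?_) ?_) ?_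
    exacts [mem (.x1 a ha), mem (.x1bar a' ha'), mem (.x2 b hb), mem (.x2bar b' hb'),
      mem (.x4 c hc), mem (.x4bar c' hc'), mem (.x5 d hd), mem (.x5bar d' hd')]

/-! ### Derivatives of the general combination -/

section Derivatives

variable {p : Total} {f : ℂ → ℂ}

theorem hasFDerivAt_comp_z₁ (hf : DifferentiableAt ℂ f p.1.1) :
    HasFDerivAt (fun q : Total => f q.1.1)
      (((fderiv ℂ f p.1.1).restrictScalars ℝ).comp ((ContinuousLinearMap.fst ℝ ℂ ℂ).comp
        (ContinuousLinearMap.fst ℝ Base ℝ))) p :=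
  HasFDerivAt.comp p (hf.hasFDerivAt.restrictScalars ℝ)
    ((ContinuousLinearMap.fst ℝ ℂ ℂ).comp (ContinuousLinearMap.fst ℝ Base ℝ)).hasFDerivAt

theorem hasFDerivAt_comp_z₂ (hf : DifferentiableAt ℂ f p.1.2) :
    HasFDerivAt (fun q : Total => f q.1.2)
      (((fderiv ℂ f p.1.2).restrictScalars ℝ).comp ((ContinuousLinearMap.snd ℝ ℂ ℂ).comp
        (ContinuousLinearMap.fst ℝ Base ℝ))) p :=
  HasFDerivAt.comp p (hf.hasFDerivAt.restrictScalars ℝ)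
    ((ContinuousLinearMap.snd ℝ ℂ ℂ).comp (ContinuousLinearMap.fst ℝ Base ℝ)).hasFDerivAt

theorem pdTotal_comp_z₁ (hf : DifferentiableAt ℂ f p.1.1) (j : Fin 4) :
    pdTotal j (fun q => f q.1.1) p = if j = 0 then deriv f p.1.1 else 0 := by
  have e : ∀ z, fderiv ℂ f p.1.1 z = z * deriv f p.1.1 := fun z => fderiv_eq_smul_deriv z
  have hII := Complex.I_mul_I
  rw [pdTotal_eq_cdir, cdir, (hasFDerivAt_comp_z₁ hf).fderiv]
  simp only [ContinuousLinearMap.comp_apply, ContinuousLinearMap.coe_restrictScalars', e]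
  fin_cases j <;> simp [reDir, imDir]
  · linear_combination -(1 / 2) * deriv f p.1.1 * hII
  · linear_combination (1 / 2) * deriv f p.1.1 * hII

theorem pdTotal_comp_z₂ (hf : DifferentiableAt ℂ f p.1.2) (j : Fin 4) :
    pdTotal j (fun q => f q.1.2) p = if j = 2 then deriv f p.1.2 else 0 := by
  have e : ∀ z, fderiv ℂ f p.1.2 z = z * deriv f p.1.2 := fun z => fderiv_eq_smul_deriv z
  have hII := Complex.I_mul_I
  rw [pdTotal_eq_cdir, cdir, (hasFDerivAt_comp_z₂ hf).fderiv]
  simp only [ContinuousLinearMap.comp_apply, ContinuousLinearMap.coe_restrictScalars', e]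
  fin_cases j <;> simp [reDir, imDir]
  · linear_combination -(1 / 2) * deriv f p.1.2 * hII
  · linear_combination (1 / 2) * deriv f p.1.2 * hII

theorem pdU_comp_z₁ (hf : DifferentiableAt ℂ f p.1.1) : pdU (fun q => f q.1.1) p = 0 := by
  simp [pdU, (hasFDerivAt_comp_z₁ hf).fderiv]

theorem pdU_comp_z₂ (hf : DifferentiableAt ℂ f p.1.2) : pdU (fun q => f q.1.2) p = 0 := by
  simp [pdU, (hasFDerivAt_comp_z₂ hf).fderiv]

/-- The involution of the indices `1, 1̄, 2, 2̄` given by conjugation. -/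
def conjIndex : Fin 4 → Fin 4 := ![1, 0, 3, 2]

theorem pdTotal_star {F : Total → ℂ} (hF : DifferentiableAt ℝ F p) (j : Fin 4) :
    pdTotal j (fun q => star (F q)) p = star (pdTotal (conjIndex j) F p) := by
  have e : ((reDir j, 0) : Total) = (reDir (conjIndex j), 0) ∧
      -((imDir j, 0) : Total) = (imDir (conjIndex j), 0) := by
    fin_cases j <;> simp [reDir, imDir, conjIndex]
  rw [pdTotal_eq_cdir, cdir_star hF, pdTotal_eq_cdir, e.1, e.2]

theorem pdU_star {F : Total → ℂ} (hF : DifferentiableAt ℝ F p) :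
    pdU (fun q => star (F q)) p = star (pdU F p) := by
  rw [pdU_eq_cdir, cdir_star hF, pdU_eq_cdir, neg_zero]

theorem hasFDerivAt_u : HasFDerivAt (fun q : Total => (q.2 : ℂ))
    (Complex.ofRealCLM.comp (ContinuousLinearMap.snd ℝ Base ℝ)) p :=
  (Complex.ofRealCLM.comp (ContinuousLinearMap.snd ℝ Base ℝ)).hasFDerivAt

theorem pdTotal_u (j : Fin 4) : pdTotal j (fun q => (q.2 : ℂ)) p = 0 := by
  simp [pdTotal_eq_cdir, cdir, hasFDerivAt_u.fderiv]

theorem pdU_u : pdU (fun q => (q.2 : ℂ)) p = 1 := by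
  simp [pdU, hasFDerivAt_u.fderiv]

theorem differentiableAt_star_comp {F : Total → ℂ} (hF : DifferentiableAt ℝ F p) :
    DifferentiableAt ℝ (fun q => star (F q)) p :=
  (Complex.conjCLE : ℂ →L[ℝ] ℂ).differentiableAt.comp p hF

section EtaForm

variable {c c' d d' : ℂ → ℂ} (k : ℂ)

theorem cdir_etaForm (v w : Total) (hc : DifferentiableAt ℂ c p.1.1)
    (hc' : DifferentiableAt ℂ c' p.1.1) (hd : DifferentiableAt ℂ d p.1.2)
    (hd' : DifferentiableAt ℂ d' p.1.2) :
    cdir v w (etaForm c c' d d' k) p = k * cdir v w (fun q => (q.2 : ℂ)) p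
      + cdir v w (fun q => c q.1.1) p + cdir v w (fun q => star (c' q.1.1)) p
      + cdir v w (fun q => d q.1.2) p + cdir v w (fun q => star (d' q.1.2)) p := by
  have e1 := (hasFDerivAt_comp_z₁ hc).differentiableAt
  have e2 := differentiableAt_star_comp (hasFDerivAt_comp_z₁ hc').differentiableAt
  have e3 := (hasFDerivAt_comp_z₂ hd).differentiableAt
  have e4 := differentiableAt_star_comp (hasFDerivAt_comp_z₂ hd').differentiableAt
  have e5 : DifferentiableAt ℝ (fun q : Total => k * (q.2 : ℂ)) p :=
    (differentiableAt_const k).fun_mul hasFDerivAt_u.differentiableAt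
  unfold etaForm
  rw [cdir_add (((e5.fun_add e1).fun_add e2).fun_add e3) e4,
    cdir_add ((e5.fun_add e1).fun_add e2) e3, cdir_add (e5.fun_add e1) e2, cdir_add e5 e1,
    cdir_mul (differentiableAt_const k) hasFDerivAt_u.differentiableAt, cdir_const, zero_mul,
    zero_add]

theorem pdTotal_etaForm (hc : DifferentiableAt ℂ c p.1.1)
    (hc' : DifferentiableAt ℂ c' p.1.1) (hd : DifferentiableAt ℂ d p.1.2)
    (hd' : DifferentiableAt ℂ d' p.1.2) (j : Fin 4) :
    pdTotal j (etaForm c c' d d' k) p = ![deriv c p.1.1, star (deriv c' p.1.1), deriv d p.1.2,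
      star (deriv d' p.1.2)] j := by
  rw [pdTotal_eq_cdir, cdir_etaForm k _ _ hc hc' hd hd']
  simp only [← pdTotal_eq_cdir]
  rw [pdTotal_u, pdTotal_star (hasFDerivAt_comp_z₁ hc').differentiableAt,
    pdTotal_star (hasFDerivAt_comp_z₂ hd').differentiableAt, pdTotal_comp_z₁ hc,
    pdTotal_comp_z₁ hc', pdTotal_comp_z₂ hd, pdTotal_comp_z₂ hd']
  fin_cases j <;> simp [conjIndex]

theorem pdU_etaForm (hc : DifferentiableAt ℂ c p.1.1)
    (hc' : DifferentiableAt ℂ c' p.1.1) (hd : DifferentiableAt ℂ d p.1.2)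
    (hd' : DifferentiableAt ℂ d' p.1.2) : pdU (etaForm c c' d d' k) p = k := by
  rw [pdU_eq_cdir, cdir_etaForm k _ _ hc hc' hd hd']
  simp only [← pdU_eq_cdir]
  rw [pdU_u, pdU_star (hasFDerivAt_comp_z₁ hc').differentiableAt,
    pdU_star (hasFDerivAt_comp_z₂ hd').differentiableAt, pdU_comp_z₁ hc, pdU_comp_z₁ hc',
    pdU_comp_z₂ hd, pdU_comp_z₂ hd']
  simp

end EtaForm

end Derivatives

/-! ### Combinations of the generators satisfy the determining equations -/

section NormalForm

variable {U : Set Total}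

theorem isOpen_image_z₁ (hU : IsOpen U) : IsOpen ((fun p : Total => p.1.1) '' U) := by
  have := isOpenMap_fst.comp (isOpenMap_fst (X := Base) (Y := ℝ))
  exact this U hU

theorem isOpen_image_z₂ (hU : IsOpen U) : IsOpen ((fun p : Total => p.1.2) '' U) := by
  have := isOpenMap_snd.comp (isOpenMap_fst (X := Base) (Y := ℝ))
  exact this U hU

theorem Hol₁.differentiableAt {f : ℂ → ℂ} (hU : IsOpen U) (hf : Hol₁ U f) {p : Total}
    (hp : p ∈ U) : DifferentiableAt ℂ f p.1.1 :=
  DifferentiableOn.differentiableAt hf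
    ((isOpen_image_z₁ hU).mem_nhds (mem_image_of_mem (fun p : Total => p.1.1) hp))

theorem Hol₂.differentiableAt {f : ℂ → ℂ} (hU : IsOpen U) (hf : Hol₂ U f) {p : Total}
    (hp : p ∈ U) : DifferentiableAt ℂ f p.1.2 :=
  DifferentiableOn.differentiableAt hf
    ((isOpen_image_z₂ hU).mem_nhds (mem_image_of_mem (fun p : Total => p.1.2) hp))

theorem Hol₁.deriv {f : ℂ → ℂ} (hU : IsOpen U) (hf : Hol₁ U f) : Hol₁ U (deriv f) :=
  DifferentiableOn.deriv hf (isOpen_image_z₁ hU)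

theorem Hol₂.deriv {f : ℂ → ℂ} (hU : IsOpen U) (hf : Hol₂ U f) : Hol₂ U (deriv f) :=
  DifferentiableOn.deriv hf (isOpen_image_z₂ hU)

theorem Hol₁.contDiffAt {f : ℂ → ℂ} (hU : IsOpen U) (hf : Hol₁ U f) {p : Total}
    (hp : p ∈ U) : ContDiffAt ℝ ∞ (fun q : Total => f q.1.1) p := by
  have h : ContDiffAt ℂ ∞ f p.1.1 :=
    (DifferentiableOn.contDiffOn hf (isOpen_image_z₁ hU)).contDiffAt
      ((isOpen_image_z₁ hU).mem_nhds (mem_image_of_mem (fun p : Total => p.1.1) hp))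
  exact ContDiffAt.comp p (h.restrict_scalars ℝ) (contDiff_fst.fst.contDiffAt)

theorem Hol₂.contDiffAt {f : ℂ → ℂ} (hU : IsOpen U) (hf : Hol₂ U f) {p : Total}
    (hp : p ∈ U) : ContDiffAt ℝ ∞ (fun q : Total => f q.1.2) p := by
  have h : ContDiffAt ℂ ∞ f p.1.2 :=
    (DifferentiableOn.contDiffOn hf (isOpen_image_z₂ hU)).contDiffAt
      ((isOpen_image_z₂ hU).mem_nhds (mem_image_of_mem (fun p : Total => p.1.2) hp))
  exact ContDiffAt.comp p (h.restrict_scalars ℝ) (contDiff_fst.snd.contDiffAt)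

theorem contDiffAt_star_comp {F : Total → ℂ} {p : Total} (hF : ContDiffAt ℝ ∞ F p) :
    ContDiffAt ℝ ∞ (fun q => star (F q)) p :=
  (Complex.conjCLE : ℂ →L[ℝ] ℂ).contDiff.contDiffAt.comp p hF

/-- The first derivatives of the components of a combination of generators. -/
theorem derivatives_of_eqOn (hU : IsOpen U) {X : VField} {a a' b b' c c' d d' : ℂ → ℂ} {k : ℂ}
    (h1 : Hol₁ U a ∧ Hol₁ U a' ∧ Hol₂ U b ∧ Hol₂ U b')
    (h2 : Hol₁ U c ∧ Hol₁ U c' ∧ Hol₂ U d ∧ Hol₂ U d')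
    (h : EqOn X (normalForm a a' b b' c c' d d' k) U) {p : Total} (hp : p ∈ U) :
    (∀ i j, pdTotal j (fun q => (X q).1 i) p = if j = i then ![deriv a p.1.1,
      star (deriv a' p.1.1), deriv b p.1.2, star (deriv b' p.1.2)] i else 0) ∧
    (∀ i, pdU (fun q => (X q).1 i) p = 0) ∧
    (∀ j, pdTotal j (fun q => (X q).2) p = ![deriv c p.1.1, star (deriv c' p.1.1),
      deriv d p.1.2, star (deriv d' p.1.2)] j) ∧
    pdU (fun q => (X q).2) p = k := by
  obtain ⟨ha, ha', hb, hb'⟩ := h1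
  obtain ⟨hc, hc', hd, hd'⟩ := h2
  have hev : X =ᶠ[nhds p] normalForm a a' b b' c c' d d' k :=
    Filter.eventually_of_mem (hU.mem_nhds hp) h
  have h1 : ∀ i, (fun q => (X q).1 i) =ᶠ[nhds p] fun q => ![a q.1.1, star (a' q.1.1), b q.1.2,
      star (b' q.1.2)] i := fun i => hev.mono fun q hq => by simp only [hq, normalForm]
  have h2 : (fun q => (X q).2) =ᶠ[nhds p] etaForm c c' d d' k :=
    hev.mono fun q hq => by simp only [hq, normalForm]
  have da := ha.differentiableAt hU hp
  have da' := ha'.differentiableAt hU hp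
  have db := hb.differentiableAt hU hp
  have db' := hb'.differentiableAt hU hp
  have dc := hc.differentiableAt hU hp
  have dc' := hc'.differentiableAt hU hp
  have dd := hd.differentiableAt hU hp
  have dd' := hd'.differentiableAt hU hp
  refine ⟨fun i j => ?_, fun i => ?_, fun j => ?_, ?_⟩
  · rw [pdTotal_congr j (h1 i)]
    fin_cases i
    · exact pdTotal_comp_z₁ da j
    · refine (pdTotal_star (hasFDerivAt_comp_z₁ da').differentiableAt j).trans ?_
      rw [pdTotal_comp_z₁ da']
      fin_cases j <;> simp [conjIndex]
    · exact pdTotal_comp_z₂ db j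
    · refine (pdTotal_star (hasFDerivAt_comp_z₂ db').differentiableAt j).trans ?_
      rw [pdTotal_comp_z₂ db']
      fin_cases j <;> simp [conjIndex]
  · rw [pdU_congr (h1 i)]
    fin_cases i
    · exact pdU_comp_z₁ da
    · refine (pdU_star (hasFDerivAt_comp_z₁ da').differentiableAt).trans ?_
      rw [pdU_comp_z₁ da', star_zero]
    · exact pdU_comp_z₂ db
    · refine (pdU_star (hasFDerivAt_comp_z₂ db').differentiableAt).trans ?_
      rw [pdU_comp_z₂ db', star_zero]
  · rw [pdTotal_congr j h2, pdTotal_etaForm k dc dc' dd dd']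
  · rw [pdU_congr h2, pdU_etaForm k dc dc' dd dd']

theorem HasNormalForm.determining (hU : IsOpen U) {X : VField} (h : HasNormalForm U X) :
    Determining U X := by
  obtain ⟨a, a', b, b', c, c', d, d', k, h1, h2, h⟩ := h
  have key := fun p hp => derivatives_of_eqOn hU h1 h2 h (p := p) hp
  obtain ⟨ha, ha', hb, hb'⟩ := h1
  obtain ⟨hc, hc', hd, hd'⟩ := h2
  have hconst : ∀ p ∈ U, pdU (fun q => (X q).2) =ᶠ[nhds p] fun _ => k := fun p hp =>
    Filter.eventually_of_mem (hU.mem_nhds hp) fun q hq => (key q hq).2.2.2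
  refine ⟨ContDiffOn.congr (fun p hp => ContDiffAt.contDiffWithinAt ?_) h, fun p hp j i hji => ?_,
    fun p hp => (key p hp).2.1, fun p hp => ?_, fun p hp i => ?_, fun p hp i j hij => ?_⟩
  · refine ContDiffAt.prodMk (contDiffAt_pi.2 fun i => ?_) ?_
    · fin_cases i
      · exact ha.contDiffAt hU hp
      · exact contDiffAt_star_comp (ha'.contDiffAt hU hp)
      · exact hb.contDiffAt hU hp
      · exact contDiffAt_star_comp (hb'.contDiffAt hU hp)
    · have hu : ContDiff ℝ ∞ (fun q : Total => (q.2 : ℂ)) :=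
        Complex.ofRealCLM.contDiff.comp contDiff_snd
      exact ((((contDiffAt_const.mul hu.contDiffAt).add (hc.contDiffAt hU hp)).add
        (contDiffAt_star_comp (hc'.contDiffAt hU hp))).add (hd.contDiffAt hU hp)).add
        (contDiffAt_star_comp (hd'.contDiffAt hU hp))
  · rw [(key p hp).1, if_neg hji]
  · rw [pdU_congr (hconst p hp), pdU_eq_cdir, cdir_const]
  · rw [pdTotal_congr i (hconst p hp), pdTotal_eq_cdir, cdir_const]
  · have e : pdTotal j (fun q => (X q).2) =ᶠ[nhds p] fun q => ![deriv c q.1.1,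
        star (deriv c' q.1.1), deriv d q.1.2, star (deriv d' q.1.2)] j :=
      Filter.eventually_of_mem (hU.mem_nhds hp) fun q hq => (key q hq).2.2.1 j
    rw [pdTotal_congr i e]
    have dc := (hc.deriv hU).differentiableAt hU hp
    have dc' := (hc'.deriv hU).differentiableAt hU hp
    have dd := (hd.deriv hU).differentiableAt hU hp
    have dd' := (hd'.deriv hU).differentiableAt hU hp
    fin_cases j
    · exact (pdTotal_comp_z₁ dc i).trans (if_neg hij)
    · refine (pdTotal_star (hasFDerivAt_comp_z₁ dc').differentiableAt i).trans ?_
      rw [pdTotal_comp_z₁ dc', if_neg, star_zero]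
      revert hij; fin_cases i <;> simp [conjIndex]
    · exact (pdTotal_comp_z₂ dd i).trans (if_neg hij)
    · refine (pdTotal_star (hasFDerivAt_comp_z₂ dd').differentiableAt i).trans ?_
      rw [pdTotal_comp_z₂ dd', if_neg, star_zero]
      revert hij; fin_cases i <;> simp [conjIndex]

/-- The commutator of two combinations of generators is again one; the commutator of the affine
parts `k u + …` in the `∂_u`-direction has no term in `u`. -/
theorem HasNormalForm.bracket (hU : IsOpen U) {X Y : VField} (hX : HasNormalForm U X)
    (hY : HasNormalForm U Y) : HasNormalForm U (VField.bracket X Y) := by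
  obtain ⟨a, a', b, b', c, c', d, d', k, h1, h2, h⟩ := hX
  obtain ⟨r, r', s, s', v, v', w, w', l, i1, i2, i⟩ := hY
  have kX := fun p hp => derivatives_of_eqOn hU h1 h2 h (p := p) hp
  have kY := fun p hp => derivatives_of_eqOn hU i1 i2 i (p := p) hp
  obtain ⟨ha, ha', hb, hb'⟩ := h1
  obtain ⟨hc, hc', hd, hd'⟩ := h2
  obtain ⟨hr, hr', hs, hs'⟩ := i1
  obtain ⟨hv, hv', hw, hw'⟩ := i2
  refine ⟨fun z => a z * deriv r z - r z * deriv a z,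
    fun z => a' z * deriv r' z - r' z * deriv a' z,
    fun z => b z * deriv s z - s z * deriv b z, fun z => b' z * deriv s' z - s' z * deriv b' z,
    fun z => a z * deriv v z - r z * deriv c z + (l * c z - k * v z),
    fun z => a' z * deriv v' z - r' z * deriv c' z + (star l * c' z - star k * v' z),
    fun z => b z * deriv w z - s z * deriv d z + (l * d z - k * w z),
    fun z => b' z * deriv w' z - s' z * deriv d' z + (star l * d' z - star k * w' z), 0,
    ⟨(ha.fun_mul (hr.deriv hU)).fun_sub (hr.fun_mul (ha.deriv hU)),
      (ha'.fun_mul (hr'.deriv hU)).fun_sub (hr'.fun_mul (ha'.deriv hU)),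
      (hb.fun_mul (hs.deriv hU)).fun_sub (hs.fun_mul (hb.deriv hU)),
      (hb'.fun_mul (hs'.deriv hU)).fun_sub (hs'.fun_mul (hb'.deriv hU))⟩,
    ⟨((ha.fun_mul (hv.deriv hU)).fun_sub (hr.fun_mul (hc.deriv hU))).fun_add
        ((hc.const_mul l).fun_sub (hv.const_mul k)),
      ((ha'.fun_mul (hv'.deriv hU)).fun_sub (hr'.fun_mul (hc'.deriv hU))).fun_add
        ((hc'.const_mul _).fun_sub (hv'.const_mul _)),
      ((hb.fun_mul (hw.deriv hU)).fun_sub (hs.fun_mul (hd.deriv hU))).fun_add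
        ((hd.const_mul l).fun_sub (hw.const_mul k)),
      ((hb'.fun_mul (hw'.deriv hU)).fun_sub (hs'.fun_mul (hd'.deriv hU))).fun_add
        ((hd'.const_mul _).fun_sub (hw'.const_mul _))⟩, fun p hp => ?_⟩
  obtain ⟨x1, x2, x3, x4⟩ := kX p hp
  obtain ⟨y1, y2, y3, y4⟩ := kY p hp
  refine Prod.ext (funext fun j => ?_) ?_
  · simp only [VField.bracket, VField.act, x1, x2, y1, y2, h hp, i hp, mul_zero, add_zero, mul_ite,
      Finset.sum_ite_eq', Finset.mem_univ, if_true]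
    fin_cases j <;> simp [normalForm]
  · simp only [VField.bracket, VField.act, x3, x4, y3, y4, h hp, i hp, Fin.sum_univ_four]
    simp [normalForm, etaForm]
    ring

end NormalForm

/-! ### Integration of the determining equations on a convex set -/

section Integration

variable {U : Set Total}

theorem exists_eq_const_of_fderiv_eq_zero (hU : IsOpen U) (hc : Convex ℝ U) {f : Total → ℂ}
    (hf : DifferentiableOn ℝ f U) (h : ∀ p ∈ U, fderiv ℝ f p = 0) : ∃ k, ∀ p ∈ U, f p = k :=
  hU.exists_is_const_of_fderiv_eq_zero hc.isPreconnected hf h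

/-- On a convex set, a function whose differential is a complex multiple of `dπ`, for a coordinate
`π` with values in `ℂ`, is a holomorphic function of `π`: it is constant on the fibres of `π`, as
these are convex. -/
theorem exists_holomorphic_factor (hU : IsOpen U) (hc : Convex ℝ U) (π : Total →L[ℝ] ℂ)
    (σ : ℂ →L[ℝ] Total) (hπσ : ∀ z, π (σ z) = z) {f D : Total → ℂ} (hf : DifferentiableOn ℝ f U)
    (h : ∀ p ∈ U, ∀ v, fderiv ℝ f p v = π v * D p) :
    ∃ a : ℂ → ℂ, DifferentiableOn ℂ a (π '' U) ∧ ∀ p ∈ U, f p = a (π p) := by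
  have hfd : ∀ p ∈ U, HasFDerivAt f (fderiv ℝ f p) p := fun p hp =>
    (hf.differentiableAt (hU.mem_nhds hp)).hasFDerivAt
  have hfib : ∀ p ∈ U, ∀ q ∈ U, π p = π q → f p = f q := by
    intro p hp q hq hpq
    have hmem : ∀ t ∈ Icc (0 : ℝ) 1, AffineMap.lineMap p q t ∈ U := fun t ht =>
      hc.lineMap_mem hp hq ht
    have hline : ∀ t ∈ Icc (0 : ℝ) 1,
        HasDerivAt (fun t : ℝ => f (AffineMap.lineMap p q t)) 0 t := fun t ht => by
      have := (hfd _ (hmem t ht)).comp_hasDerivAt t (AffineMap.hasDerivAt_lineMap (a := p) (b := q))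
      rwa [h _ (hmem t ht), map_sub, hpq, sub_self, zero_mul] at this
    have := constant_of_has_deriv_right_zero
      (fun t ht => (hline t ht).continuousAt.continuousWithinAt)
      (fun t ht => (hline t (Ico_subset_Icc_self ht)).hasDerivWithinAt) 1 (by simp)
    simpa using this.symm
  choose! s hsU hs using fun z (hz : z ∈ π '' U) => hz
  refine ⟨fun z => f (s z), ?_, fun p hp => ?_⟩
  · rintro _ ⟨p, hp, rfl⟩
    have hlift : ContinuousAt (fun z => p + σ (z - π p)) (π p) := by fun_prop
    have h0 : p + σ (π p - π p) = p := by simp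
    have hev : (fun z => f (s z)) =ᶠ[nhds (π p)] fun z => f (p + σ (z - π p)) := by
      have : ∀ᶠ z in nhds (π p), p + σ (z - π p) ∈ U :=
        hlift.eventually_mem (by rw [h0]; exact hU.mem_nhds hp)
      refine this.mono fun z hz => ?_
      have hz' : π (p + σ (z - π p)) = z := by rw [map_add, hπσ]; ring
      have hmem : z ∈ π '' U := ⟨_, hz, hz'⟩
      exact hfib _ (hsU z hmem) _ hz ((hs z hmem).trans hz'.symm)
    have hσ : HasFDerivAt (fun z => p + σ (z - π p)) σ (π p) := by
      have := (σ.hasFDerivAt.comp (π p) ((hasFDerivAt_id (π p)).sub_const (π p))).const_add p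
      simpa using this
    have hder : HasFDerivAt (fun z => f (p + σ (z - π p))) ((fderiv ℝ f p).comp σ) (π p) :=
      HasFDerivAt.comp (π p) (by rw [h0]; exact hfd p hp) hσ
    have hC : HasFDerivAt (𝕜 := ℂ) (fun z => f (p + σ (z - π p)))
        (ContinuousLinearMap.toSpanSingleton ℂ (D p)) (π p) := by
      refine hasFDerivAt_of_restrictScalars ℝ hder ?_
      ext1 z
      simp [h p hp, hπσ]
    exact (hC.differentiableAt.congr_of_eventuallyEq hev).differentiableWithinAt
  · exact hfib p hp _ (hsU _ (mem_image_of_mem π hp)) (hs _ (mem_image_of_mem π hp)).symm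

theorem exists_hol₁ (hU : IsOpen U) (hc : Convex ℝ U) {f : Total → ℂ}
    (hf : DifferentiableOn ℝ f U) (h : ∀ p ∈ U, ∀ j, j ≠ 0 → pdTotal j f p = 0)
    (hu : ∀ p ∈ U, pdU f p = 0) : ∃ a, Hol₁ U a ∧ ∀ p ∈ U, f p = a p.1.1 :=
  exists_holomorphic_factor hU hc ((ContinuousLinearMap.fst ℝ ℂ ℂ).comp
      (ContinuousLinearMap.fst ℝ Base ℝ))
    ((ContinuousLinearMap.inl ℝ Base ℝ).comp (ContinuousLinearMap.inl ℝ ℂ ℂ)) (by simp)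
    (D := pdTotal 0 f) hf fun p hp v => by
      rw [fderiv_total_apply, h p hp 1 (by decide), h p hp 2 (by decide), h p hp 3 (by decide),
        hu p hp]
      simp

theorem exists_hol₂ (hU : IsOpen U) (hc : Convex ℝ U) {f : Total → ℂ}
    (hf : DifferentiableOn ℝ f U) (h : ∀ p ∈ U, ∀ j, j ≠ 2 → pdTotal j f p = 0)
    (hu : ∀ p ∈ U, pdU f p = 0) : ∃ a, Hol₂ U a ∧ ∀ p ∈ U, f p = a p.1.2 :=
  exists_holomorphic_factor hU hc ((ContinuousLinearMap.snd ℝ ℂ ℂ).comp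
      (ContinuousLinearMap.fst ℝ Base ℝ))
    ((ContinuousLinearMap.inl ℝ Base ℝ).comp (ContinuousLinearMap.inr ℝ ℂ ℂ)) (by simp)
    (D := pdTotal 2 f) hf fun p hp v => by
      rw [fderiv_total_apply, h p hp 1 (by decide), h p hp 0 (by decide), h p hp 3 (by decide),
        hu p hp]
      simp

theorem differentiableOn_star_comp {F : Total → ℂ} (hU : IsOpen U) (hF : DifferentiableOn ℝ F U) :
    DifferentiableOn ℝ (fun q => star (F q)) U := fun _ hp =>
  (differentiableAt_star_comp (hF.differentiableAt (hU.mem_nhds hp))).differentiableWithinAt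

theorem exists_antihol₁ (hU : IsOpen U) (hc : Convex ℝ U) {f : Total → ℂ}
    (hf : DifferentiableOn ℝ f U) (h : ∀ p ∈ U, ∀ j, j ≠ 1 → pdTotal j f p = 0)
    (hu : ∀ p ∈ U, pdU f p = 0) : ∃ a, Hol₁ U a ∧ ∀ p ∈ U, f p = star (a p.1.1) := by
  have hd := fun p hp => hf.differentiableAt (hU.mem_nhds (x := p) hp)
  obtain ⟨a, ha, hfa⟩ := exists_hol₁ hU hc (differentiableOn_star_comp hU hf)
    (fun p hp j hj => by
      rw [pdTotal_star (hd p hp), h p hp, star_zero]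
      revert hj; fin_cases j <;> simp [conjIndex])
    (fun p hp => by rw [pdU_star (hd p hp), hu p hp, star_zero])
  exact ⟨a, ha, fun p hp => by rw [← hfa p hp, star_star]⟩

theorem exists_antihol₂ (hU : IsOpen U) (hc : Convex ℝ U) {f : Total → ℂ}
    (hf : DifferentiableOn ℝ f U) (h : ∀ p ∈ U, ∀ j, j ≠ 3 → pdTotal j f p = 0)
    (hu : ∀ p ∈ U, pdU f p = 0) : ∃ a, Hol₂ U a ∧ ∀ p ∈ U, f p = star (a p.1.2) := by
  have hd := fun p hp => hf.differentiableAt (hU.mem_nhds (x := p) hp)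
  obtain ⟨a, ha, hfa⟩ := exists_hol₂ hU hc (differentiableOn_star_comp hU hf)
    (fun p hp j hj => by
      rw [pdTotal_star (hd p hp), h p hp, star_zero]
      revert hj; fin_cases j <;> simp [conjIndex])
    (fun p hp => by rw [pdU_star (hd p hp), hu p hp, star_zero])
  exact ⟨a, ha, fun p hp => by rw [← hfa p hp, star_star]⟩

theorem exists_primitive {V : Set ℂ} (hV : IsOpen V) (hc : Convex ℝ V) {f : ℂ → ℂ}
    (hf : DifferentiableOn ℂ f V) :
    ∃ g, DifferentiableOn ℂ g V ∧ ∀ z ∈ V, deriv g z = f z := by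
  obtain ⟨g, hg⟩ := hc.exists_forall_hasDerivWithinAt hf
  exact ⟨g, fun z hz => (hg z hz).differentiableWithinAt,
    fun z hz => ((hg z hz).hasDerivAt (hV.mem_nhds hz)).deriv⟩

theorem Hol₁.exists_primitive (hU : IsOpen U) (hc : Convex ℝ U) {f : ℂ → ℂ} (hf : Hol₁ U f) :
    ∃ g, Hol₁ U g ∧ ∀ p ∈ U, _root_.deriv g p.1.1 = f p.1.1 := by
  obtain ⟨g, hg, h⟩ := Heavenly.exists_primitive (isOpen_image_z₁ hU)
    (hc.linear_image ((LinearMap.fst ℝ ℂ ℂ).comp (LinearMap.fst ℝ Base ℝ))) hf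
  exact ⟨g, hg, fun p hp => h _ (mem_image_of_mem _ hp)⟩

theorem Hol₂.exists_primitive (hU : IsOpen U) (hc : Convex ℝ U) {f : ℂ → ℂ} (hf : Hol₂ U f) :
    ∃ g, Hol₂ U g ∧ ∀ p ∈ U, _root_.deriv g p.1.2 = f p.1.2 := by
  obtain ⟨g, hg, h⟩ := Heavenly.exists_primitive (isOpen_image_z₂ hU)
    (hc.linear_image ((LinearMap.snd ℝ ℂ ℂ).comp (LinearMap.fst ℝ Base ℝ))) hf
  exact ⟨g, hg, fun p hp => h _ (mem_image_of_mem _ hp)⟩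

theorem Determining.hasNormalForm (hU : IsOpen U) (hc : Convex ℝ U) {X : VField}
    (h : Determining U X) : HasNormalForm U X := by
  have hX := fun p hp => contDiffAt_of_contDiffOn hU h.smooth (p := p) hp
  have n0 : (∞ : WithTop ℕ∞) ≠ 0 := by simp
  have hξ : ∀ k, DifferentiableOn ℝ (fun q => (X q).1 k) U := fun k p hp =>
    ((contDiffAt_xi (hX p hp) k).differentiableAt n0).differentiableWithinAt
  have hηi : ∀ i, DifferentiableOn ℝ (pdTotal i fun q => (X q).2) U := fun i p hp =>
    ((pdTotal_contDiffAt i (hX p hp).snd).differentiableAt n0).differentiableWithinAt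
  have hηu : DifferentiableOn ℝ (pdU fun q => (X q).2) U := fun p hp =>
    ((pdU_contDiffAt (hX p hp).snd).differentiableAt n0).differentiableWithinAt
  obtain ⟨a, ha, hXa⟩ := exists_hol₁ hU hc (hξ 0) (fun p hp j => h.xi p hp j 0)
    (fun p hp => h.xi_u p hp 0)
  obtain ⟨a', ha', hXa'⟩ := exists_antihol₁ hU hc (hξ 1) (fun p hp j => h.xi p hp j 1)
    (fun p hp => h.xi_u p hp 1)
  obtain ⟨b, hb, hXb⟩ := exists_hol₂ hU hc (hξ 2) (fun p hp j => h.xi p hp j 2)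
    (fun p hp => h.xi_u p hp 2)
  obtain ⟨b', hb', hXb'⟩ := exists_antihol₂ hU hc (hξ 3) (fun p hp j => h.xi p hp j 3)
    (fun p hp => h.xi_u p hp 3)
  obtain ⟨k, hk⟩ := exists_eq_const_of_fderiv_eq_zero hU hc hηu fun p hp => by
    refine ContinuousLinearMap.ext fun v => ?_
    rw [fderiv_total_apply, h.eta_iu p hp, h.eta_iu p hp, h.eta_iu p hp, h.eta_iu p hp,
      h.eta_uu p hp]
    simp
  -- the derivatives of `η` depend on one variable each, and are integrated on the projections
  have hiu : ∀ p ∈ U, ∀ i, pdU (pdTotal i fun q => (X q).2) p = 0 := fun p hp i => by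
    rw [← pdTotal_pdU_comm i (hX p hp).snd, h.eta_iu p hp]
  obtain ⟨c₀, hc₀, hXc₀⟩ := exists_hol₁ hU hc (hηi 0) (fun p hp j => h.eta_ij p hp j 0)
    (fun p hp => hiu p hp 0)
  obtain ⟨c₀', hc₀', hXc₀'⟩ := exists_antihol₁ hU hc (hηi 1) (fun p hp j => h.eta_ij p hp j 1)
    (fun p hp => hiu p hp 1)
  obtain ⟨d₀, hd₀, hXd₀⟩ := exists_hol₂ hU hc (hηi 2) (fun p hp j => h.eta_ij p hp j 2)
    (fun p hp => hiu p hp 2)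
  obtain ⟨d₀', hd₀', hXd₀'⟩ := exists_antihol₂ hU hc (hηi 3) (fun p hp j => h.eta_ij p hp j 3)
    (fun p hp => hiu p hp 3)
  obtain ⟨c, hhc, hc1⟩ := hc₀.exists_primitive hU hc
  obtain ⟨c', hhc', hc1'⟩ := hc₀'.exists_primitive hU hc
  obtain ⟨d, hhd, hd1⟩ := hd₀.exists_primitive hU hc
  obtain ⟨d', hhd', hd1'⟩ := hd₀'.exists_primitive hU hc
  have hη : ∀ p ∈ U, DifferentiableAt ℝ (fun q => (X q).2) p := fun p hp =>
    (hX p hp).snd.differentiableAt n0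
  have hform : ∀ p ∈ U, DifferentiableAt ℝ (etaForm c c' d d' k) p := fun p hp => by
    have e1 := (hasFDerivAt_comp_z₁ (hhc.differentiableAt hU hp)).differentiableAt
    have e2 := differentiableAt_star_comp
      (hasFDerivAt_comp_z₁ (hhc'.differentiableAt hU hp)).differentiableAt
    have e3 := (hasFDerivAt_comp_z₂ (hhd.differentiableAt hU hp)).differentiableAt
    have e4 := differentiableAt_star_comp
      (hasFDerivAt_comp_z₂ (hhd'.differentiableAt hU hp)).differentiableAt
    exact (((((differentiableAt_const k).fun_mul hasFDerivAt_u.differentiableAt).fun_add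
      e1).fun_add e2).fun_add e3).fun_add e4
  obtain ⟨e, he⟩ := exists_eq_const_of_fderiv_eq_zero hU hc
    (f := fun q => (X q).2 - etaForm c c' d d' k q)
    (fun p hp => ((hη p hp).fun_sub (hform p hp)).differentiableWithinAt) fun p hp => by
      have dc := hhc.differentiableAt hU hp
      have dc' := hhc'.differentiableAt hU hp
      have dd := hhd.differentiableAt hU hp
      have dd' := hhd'.differentiableAt hU hp
      rw [fderiv_fun_sub (hη p hp) (hform p hp)]
      refine ContinuousLinearMap.ext fun v => ?_
      rw [sub_apply, fderiv_total_apply, fderiv_total_apply, pdU_etaForm k dc dc' dd dd', hk p hp]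
      simp only [pdTotal_etaForm k dc dc' dd dd', Matrix.cons_val, hc1 p hp, hc1' p hp, hd1 p hp,
        hd1' p hp, hXc₀ p hp, hXc₀' p hp, hXd₀ p hp, hXd₀' p hp]
      simp
  refine ⟨a, a', b, b', fun z => c z + e, c', d, d', k, ⟨ha, ha', hb, hb'⟩,
    ⟨hhc.add_const e, hhc', hhd, hhd'⟩, fun p hp => Prod.ext (funext fun i => ?_) ?_⟩
  · fin_cases i
    · exact hXa p hp
    · exact hXa' p hp
    · exact hXb p hp
    · exact hXb' p hp
  · have := he p hp
    simp only [normalForm, etaForm] at this ⊢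
    linear_combination this

end Integration

/-! ### Localization and real vector fields -/

section Local

variable {U V : Set Total} {X : VField}

theorem Determining.mono (h : Determining U X) (hVU : V ⊆ U) : Determining V X :=
  ⟨h.smooth.mono hVU, fun p hp => h.xi p (hVU hp), fun p hp => h.xi_u p (hVU hp),
    fun p hp => h.eta_uu p (hVU hp), fun p hp => h.eta_iu p (hVU hp),
    fun p hp => h.eta_ij p (hVU hp)⟩

theorem Determining.of_local
    (h : ∀ p ∈ U, ∃ V : Set Total, V ⊆ U ∧ IsOpen V ∧ p ∈ V ∧ Determining V X) :
    Determining U X := by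
  choose! V _ hV hp hX using h
  exact ⟨fun p hpU => ((hX p hpU).smooth.contDiffAt
      ((hV p hpU).mem_nhds (hp p hpU))).contDiffWithinAt,
    fun p hpU => (hX p hpU).xi p (hp p hpU), fun p hpU => (hX p hpU).xi_u p (hp p hpU),
    fun p hpU => (hX p hpU).eta_uu p (hp p hpU), fun p hpU => (hX p hpU).eta_iu p (hp p hpU),
    fun p hpU => (hX p hpU).eta_ij p (hp p hpU)⟩

theorem exists_convex_nhds (hU : IsOpen U) {p : Total} (hp : p ∈ U) :
    ∃ V : Set Total, V ⊆ U ∧ IsOpen V ∧ p ∈ V ∧ Convex ℝ V := by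
  obtain ⟨ε, hε, h⟩ := Metric.isOpen_iff.1 hU p hp
  exact ⟨Metric.ball p ε, h, Metric.isOpen_ball, Metric.mem_ball_self hε, convex_ball p ε⟩

theorem isReal_normalForm (a b c d : ℂ → ℂ) (k : ℝ) (p : Total) :
    (normalForm a a b b c c d d k p).1 1 = star ((normalForm a a b b c c d d k p).1 0) ∧
    (normalForm a a b b c c d d k p).1 3 = star ((normalForm a a b b c c d d k p).1 2) ∧
    (normalForm a a b b c c d d k p).2.im = 0 := by
  simp [normalForm, etaForm]

/-- In a real combination of generators the coefficient functions may be chosen conjugate in pairs: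
for the `∂_u`-component, they are replaced by those of its real part. -/
theorem isRealGenerated_iff : IsRealGenerated U X ↔ VField.IsReal U X ∧ HasNormalForm U X := by
  constructor
  · rintro ⟨a, b, c, d, k, ha, hb, hc, hd, h⟩
    rw [← normalForm_eq_sum] at h
    refine ⟨fun p hp => ?_, ⟨a, a, b, b, c, c, d, d, k, ⟨ha, ha, hb, hb⟩, ⟨hc, hc, hd, hd⟩, h⟩⟩
    rw [h hp]
    exact isReal_normalForm a b c d k p
  · rintro ⟨hr, a, a', b, b', c, c', d, d', k, ⟨ha, ha', hb, hb'⟩, ⟨hc, hc', hd, hd'⟩, h⟩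
    refine ⟨a, b, fun z => (1 / 2) * (c z + c' z), fun z => (1 / 2) * (d z + d' z), k.re, ha, hb,
      (hc.fun_add hc').const_mul _, (hd.fun_add hd').const_mul _, fun p hp => ?_⟩
    rw [← normalForm_eq_sum]
    obtain ⟨h1, h2, h3⟩ := hr p hp
    have hη : (X p).2 = ((X p).2 + star (X p).2) / 2 := by
      rw [show star (X p).2 = (X p).2 from Complex.conj_eq_iff_im.2 h3]; ring
    have hk : ((k.re : ℝ) : ℂ) = (k + star k) / 2 := by
      rw [Complex.re_eq_add_conj]; rfl
    rw [h hp] at h1 h2 hη ⊢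
    refine Prod.ext (funext fun i => ?_) ?_
    · fin_cases i
      · rfl
      · exact h1
      · rfl
      · exact h2
    · rw [hη]
      simp only [normalForm, etaForm, hk]
      simp
      ring

end Local

end Heavenly

end

theorem mainTheorem6 (δ : ℝ) (hδ : 0 < δ) (hδ1 : δ ≠ 1)
    (U : Set Heavenly.Total) (hU : IsOpen U) :
    -- on a convex domain, the symmetries are exactly the combinations of the listed generators,
    -- both for complexified and for real vector fields
    (Convex ℝ U →
      (∀ X : Heavenly.VField,
        Heavenly.IsPointSymmetry δ U X ↔ Heavenly.IsGenerated U X) ∧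
      (∀ X : Heavenly.VField,
        (Heavenly.VField.IsReal U X ∧ Heavenly.IsPointSymmetry δ U X) ↔
          Heavenly.IsRealGenerated U X)) ∧
    -- on any open set, the same holds locally
    (∀ X : Heavenly.VField,
      Heavenly.IsPointSymmetry δ U X ↔
        ∀ p ∈ U, ∃ V : Set Heavenly.Total, V ⊆ U ∧ IsOpen V ∧ p ∈ V ∧
          Heavenly.IsGenerated V X) ∧
    (∀ X : Heavenly.VField,
      (Heavenly.VField.IsReal U X ∧ Heavenly.IsPointSymmetry δ U X) ↔
        ∀ p ∈ U, ∃ V : Set Heavenly.Total, V ⊆ U ∧ IsOpen V ∧ p ∈ V ∧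
          Heavenly.IsRealGenerated V X) ∧
    -- the symmetries are closed under commutators
    (∀ X Y : Heavenly.VField,
      Heavenly.IsPointSymmetry δ U X → Heavenly.IsPointSymmetry δ U Y →
        Heavenly.IsPointSymmetry δ U (Heavenly.VField.bracket X Y)) := by
  have hdet : ∀ X, Heavenly.IsPointSymmetry δ U X ↔ Heavenly.Determining U X := fun X =>
    ⟨fun h => h.determining hδ hδ1 hU, fun h => h.isPointSymmetry hU⟩
  simp only [hdet, Heavenly.isGenerated_iff_hasNormalForm, Heavenly.isRealGenerated_iff]
  refine ⟨fun hc => ?_, fun X => ⟨fun h p hp => ?_, fun h => ?_⟩,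
    fun X => ⟨fun h p hp => ?_, fun h => ⟨fun p hp => ?_, ?_⟩⟩, fun X Y hX hY => ?_⟩
  · have hnf : ∀ X, Heavenly.Determining U X ↔ Heavenly.HasNormalForm U X := fun X =>
      ⟨fun h => h.hasNormalForm hU hc, fun h => h.determining hU⟩
    simp only [hnf, implies_true, and_self]
  · obtain ⟨V, hVU, hV, hpV, hVc⟩ := Heavenly.exists_convex_nhds hU hp
    exact ⟨V, hVU, hV, hpV, (h.mono hVU).hasNormalForm hV hVc⟩
  · refine Heavenly.Determining.of_local fun p hp => ?_
    obtain ⟨V, hVU, hV, hpV, h⟩ := h p hp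
    exact ⟨V, hVU, hV, hpV, h.determining hV⟩
  · obtain ⟨V, hVU, hV, hpV, hVc⟩ := Heavenly.exists_convex_nhds hU hp
    exact ⟨V, hVU, hV, hpV, fun q hq => h.1 q (hVU hq), (h.2.mono hVU).hasNormalForm hV hVc⟩
  · obtain ⟨V, _, _, hpV, h, _⟩ := h p hp
    exact h p hpV
  · refine Heavenly.Determining.of_local fun p hp => ?_
    obtain ⟨V, hVU, hV, hpV, _, h⟩ := h p hp
    exact ⟨V, hVU, hV, hpV, h.determining hV⟩
  · refine Heavenly.Determining.of_local fun p hp => ?_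
    obtain ⟨V, hVU, hV, hpV, hVc⟩ := Heavenly.exists_convex_nhds hU hp
    exact ⟨V, hVU, hV, hpV, (((hX.mono hVU).hasNormalForm hV hVc).bracket hV
      ((hY.mono hVU).hasNormalForm hV hVc)).determining hV⟩
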